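/- Manifolds are smooth, finite dimensional, without boundary, possibly with components of different dimensions. A Lie groupoid $G$ over a Hausdorff manifold $M$ has a possibly non-Hausdorff manifold $G$ of arrows, submersions $s,t:G\to M$ (source and target), and smooth multiplication $(g,h)\mapsto gh$ (defined when $s(g)=t(h)$), inverse and units $x\mapsto 1_x$. For $x\in M$ let $F_x\subset T_xM$ be the image of the anchor, i.e. of $dt:\ker(ds)_{1_x}\to T_xM$. The groupoid $G$ is regular if $\dim F_x$ is locally constant in $x$; then $F=(F_x)$ is the tangent bundle of the orbit foliation. A bundle of connected Lie groups is a Lie groupoid with $s=t$ whose fibers are connected. A foliation groupoid is a Lie groupoid for which all fibers of $(s,t):G\to M\times M$ are discrete, and a Lie groupoid is étale if $s$ and $t$ are local diffeomorphisms. Let $I(G)_x=\{g\in G: s(g)=t(g)=x\}$ be the isotropy groups, $I(G)_x^\circ$ the connected component of $1_x$ in $I(G)_x$, and $I(G)^\circ=\bigcup_{x}I(G)_x^\circ$. **Proposition 2.5.** Let $G$ be a regular Lie groupoid over $M$. Then there is an extension of Lie groupoids over $M$ $$I(G)^\circ\xrightarrow{\;j\;}G\xrightarrow{\;\pi\;}E$$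 such that: 1. $I(G)^\circ$ is a bundle of connected Lie groups over $M$, and $j$ is a smooth embedding and a groupoid homomorphism over $\mathrm{id}_M$, with image the union of the groups $I(G)_x^\circ$. 2. $E$ is a foliation groupoid over $M$, and $\pi$ is a groupoid homomorphism over $\mathrm{id}_M$ and a surjective submersion with connected fibers. 3. The image of $j$ is the kernel of $\pi$, and $E=G/I(G)^\circ$: one has $\pi(g)=\pi(h)$ if and only if $h=gk$ for some $k\in I(G)^\circ$ with $s(g)=t(k)$. 4. Let $T\subset M$ be a transversal to the orbit foliation, i.e. an embedded submanifold with $T_xM=F_x\oplus T_xT$ for all $x\in T$ (for instance a complete transversal, one that meets every leaf). Then $G_T=\{g\in G: s(g),t(g)\in T\}$ and $E_T=\{e\in E: s(e),t(e)\in T\}$ are embedded submanifolds of $G$ and $E$ and Lie groupoids over $T$, the groupoid $E_T$ is étale, and $\pi$ restricts to a homomorphism $\pi_T:G_T\to E_T$ that is a submersion with connected (non-empty) fibers and satisfies $s|_{G_T}=s|_{E_T}\circ\pi_T$. In other words, the restriction of $E$ to $T$ is the étale groupoid whose arrows are the connected components of the source fibers of $G_T$. -/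

import Mathlib

open Set Topology
open scoped ContDiff

universe u v w

namespace LieGpd

/-! ## Manifolds

All manifolds are smooth, finite dimensional, without boundary, not necessarily Hausdorff.
Different components may have different dimensions. (Mathlib's `ChartedSpace` fixes one model
space, hence one dimension. This is too restrictive here: over a disconnected base the rank of a
regular groupoid, and with it the dimension of the quotient groupoid, may jump from one component
to another.) -/

/-- The Euclidean space of dimension `n`. -/
abbrev Euc (n : ℕ) : Type := EuclideanSpace ℝ (Fin n)

/-- A smooth atlas on the topological space `X`; `charts n` are its charts with values in
`n`-dimensional Euclidean space. -/
class SmoothManifold (X : Type u) [TopologicalSpace X] where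
  charts : ∀ n : ℕ, Set (OpenPartialHomeomorph X (Euc n))
  exists_chart : ∀ x : X, ∃ n : ℕ, ∃ c ∈ charts n, x ∈ c.source
  compatible : ∀ {n k : ℕ}, ∀ c ∈ charts n, ∀ d ∈ charts k,
    ContDiffOn ℝ ∞ (d ∘ c.symm) (c.target ∩ c.symm ⁻¹' d.source)

section Manifolds

variable {X : Type u} [TopologicalSpace X] [SmoothManifold X]
variable {Y : Type v} [TopologicalSpace Y] [SmoothManifold Y]
variable {Z : Type w} [TopologicalSpace Z] [SmoothManifold Z]

/-- The dimension of `X` at `x`. -/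
noncomputable def dimAt (x : X) : ℕ := (SmoothManifold.exists_chart x).choose

/-- A preferred chart around `x`. -/
noncomputable def chartNear (x : X) : OpenPartialHomeomorph X (Euc (dimAt x)) :=
  (SmoothManifold.exists_chart x).choose_spec.choose

theorem chartNear_mem (x : X) : chartNear x ∈ SmoothManifold.charts (X := X) (dimAt x) :=
  (SmoothManifold.exists_chart x).choose_spec.choose_spec.1

theorem mem_chartNear_source (x : X) : x ∈ (chartNear x).source :=
  (SmoothManifold.exists_chart x).choose_spec.choose_spec.2

/-- The tangent space of `X` at `x`, identified with Euclidean space by the preferred chart. -/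
abbrev Tan (x : X) : Type := Euc (dimAt x)

/-- `f` is smooth on the (open) set `U`: it is continuous there and smooth in all charts. -/
def SmoothOn (f : X → Y) (U : Set X) : Prop :=
  ContinuousOn f U ∧
    ∀ (n k : ℕ), ∀ c ∈ SmoothManifold.charts (X := X) n, ∀ d ∈ SmoothManifold.charts (X := Y) k,
      ContDiffOn ℝ ∞ (fun v => d (f (c.symm v)))
        {v | v ∈ c.target ∧ c.symm v ∈ U ∧ f (c.symm v) ∈ d.source}

/-- Smooth maps. -/
def Smooth (f : X → Y) : Prop := SmoothOn f univ

/-- The tangent map of `f` at `x`, with values in the tangent space at `y = f x`. -/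
noncomputable def tanMap (f : X → Y) (x : X) {y : Y} (_h : f x = y) : Tan x →L[ℝ] Tan y :=
  fderiv ℝ (fun v => chartNear y (f ((chartNear x).symm v))) (chartNear x x)

/-- Submersions (not necessarily surjective). -/
def IsSubmersion (f : X → Y) : Prop :=
  Smooth f ∧ ∀ x, Function.Surjective (tanMap f x rfl)

/-- Smooth embeddings: immersions that are homeomorphisms onto their image. -/
def IsSmoothEmbedding (f : X → Y) : Prop :=
  Smooth f ∧ (∀ x, Function.Injective (tanMap f x rfl)) ∧ IsEmbedding f

/-- Local diffeomorphisms (etale maps). -/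
def IsLocalDiffeo (f : X → Y) : Prop :=
  ∀ x, ∃ Φ : OpenPartialHomeomorph X Y, x ∈ Φ.source ∧ EqOn f Φ Φ.source ∧
    SmoothOn Φ Φ.source ∧ SmoothOn Φ.symm Φ.target

/-- `f = e ∘ p` is the factorization of the submersion `f` through its space of fiberwise
connected components: `p` is a submersion with connected (non-empty) fibers and `e` is etale. -/
structure IsComponentFactorization (f : X → Z) (p : X → Y) (e : Y → Z) : Prop where
  comp_eq : ∀ x, e (p x) = f x
  submersion : IsSubmersion p
  connected_fibers : ∀ y, IsConnected (p ⁻¹' {y})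
  etale : IsLocalDiffeo e

end Manifolds

/-! ## Groupoids -/

/-- A groupoid with set of objects `M` and set of arrows `G`. The product `mul g h` is meaningful
only if `s g = t h`; its other values are arbitrary and never used. -/
structure GroupoidStr (M : Type u) (G : Type v) where
  s : G → M
  t : G → M
  mul : G → G → G
  inv : G → G
  one : M → G
  s_mul : ∀ {g h}, s g = t h → s (mul g h) = s h
  t_mul : ∀ {g h}, s g = t h → t (mul g h) = t g
  mul_assoc : ∀ {g h k}, s g = t h → s h = t k → mul (mul g h) k = mul g (mul h k)
  s_one : ∀ x, s (one x) = x
  t_one : ∀ x, t (one x) = x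
  one_mul : ∀ g, mul (one (t g)) g = g
  mul_one : ∀ g, mul g (one (s g)) = g
  s_inv : ∀ g, s (inv g) = t g
  t_inv : ∀ g, t (inv g) = s g
  inv_mul : ∀ g, mul (inv g) g = one (s g)
  mul_inv : ∀ g, mul g (inv g) = one (t g)

namespace GroupoidStr

section Algebra

variable {M : Type u} {G : Type v} (Γ : GroupoidStr M G)

/-- The arrows with source and target in `T`. -/
def arrowsOver (T : Set M) : Set G := {g | Γ.s g ∈ T ∧ Γ.t g ∈ T}

open Classical in
/-- The restriction of a groupoid to a set `T` of objects. -/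
noncomputable def restrict (T : Set M) : GroupoidStr T (Γ.arrowsOver T) where
  s g := ⟨Γ.s g, g.2.1⟩
  t g := ⟨Γ.t g, g.2.2⟩
  mul g h := if e : Γ.s g = Γ.t h then
      ⟨Γ.mul g h, by rw [Γ.s_mul e]; exact h.2.1, by rw [Γ.t_mul e]; exact g.2.2⟩
    else g
  inv g := ⟨Γ.inv g, by rw [Γ.s_inv]; exact g.2.2, by rw [Γ.t_inv]; exact g.2.1⟩
  one x := ⟨Γ.one x, by rw [Γ.s_one]; exact x.2, by rw [Γ.t_one]; exact x.2⟩
  s_mul {g h} e := by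
    have e' : Γ.s g = Γ.t h := congrArg Subtype.val e
    simp [e', Γ.s_mul e']
  t_mul {g h} e := by
    have e' : Γ.s g = Γ.t h := congrArg Subtype.val e
    simp [e', Γ.t_mul e']
  mul_assoc {g h k} e f := by
    have e' : Γ.s g = Γ.t h := congrArg Subtype.val e
    have f' : Γ.s h = Γ.t k := congrArg Subtype.val f
    simp [e', f', Γ.s_mul e', Γ.t_mul f', Γ.mul_assoc e' f']
  s_one x := Subtype.ext (Γ.s_one x)
  t_one x := Subtype.ext (Γ.t_one x)
  one_mul g := by simp [Γ.s_one, Γ.one_mul]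
  mul_one g := by simp [Γ.t_one, Γ.mul_one]
  s_inv g := Subtype.ext (Γ.s_inv g)
  t_inv g := Subtype.ext (Γ.t_inv g)
  inv_mul g := by simp [Γ.s_inv, Γ.inv_mul]
  mul_inv g := by simp [Γ.t_inv, Γ.mul_inv]

/-- The isotropy group at `x`: the arrows from `x` to `x`. -/
def isotropy (x : M) : Set G := {g | Γ.s g = x ∧ Γ.t g = x}

/-- The union over all `x` of the identity components of the isotropy groups
(each with the topology induced by `G`). -/
def isotropyIdentity [TopologicalSpace G] : Set G :=
  {g | ∃ x, g ∈ connectedComponentIn (Γ.isotropy x) (Γ.one x)}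

end Algebra

/-- Homomorphisms of groupoids over the identity of the set of objects. -/
structure IsHom {M : Type u} {G : Type v} {H : Type w} (Γ : GroupoidStr M G)
    (Δ : GroupoidStr M H) (φ : G → H) : Prop where
  s_map : ∀ g, Δ.s (φ g) = Γ.s g
  t_map : ∀ g, Δ.t (φ g) = Γ.t g
  map_mul : ∀ g h, Γ.s g = Γ.t h → φ (Γ.mul g h) = Δ.mul (φ g) (φ h)
  map_inv : ∀ g, φ (Γ.inv g) = Δ.inv (φ g)
  map_one : ∀ x, φ (Γ.one x) = Δ.one x

section Lie

variable {M : Type u} [TopologicalSpace M] [SmoothManifold M]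
variable {G : Type v} [TopologicalSpace G] [SmoothManifold G] (Γ : GroupoidStr M G)

/-- The product is smooth on the submanifold of composable pairs of `G × G`. -/
def SmoothMul : Prop :=
  ContinuousOn (fun p : G × G => Γ.mul p.1 p.2) {p | Γ.s p.1 = Γ.t p.2} ∧
    ∀ (n k l : ℕ), ∀ c ∈ SmoothManifold.charts (X := G) n,
      ∀ d ∈ SmoothManifold.charts (X := G) k, ∀ e ∈ SmoothManifold.charts (X := G) l,
      ContDiffOn ℝ ∞ (fun p : Euc n × Euc k => e (Γ.mul (c.symm p.1) (d.symm p.2)))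
        {p | p.1 ∈ c.target ∧ p.2 ∈ d.target ∧ Γ.s (c.symm p.1) = Γ.t (d.symm p.2) ∧
          Γ.mul (c.symm p.1) (d.symm p.2) ∈ e.source}

/-- Lie groupoids over a Hausdorff manifold `M`; the manifold `G` of arrows need not be
Hausdorff. -/
structure IsLie : Prop where
  hausdorff : T2Space M
  s_submersion : IsSubmersion Γ.s
  t_submersion : IsSubmersion Γ.t
  smooth_mul : Γ.SmoothMul
  smooth_inv : Smooth Γ.inv
  smooth_one : Smooth Γ.one

/-- The image in the tangent space at `x` of the anchor map of the Lie algebroid of `G`. The fiber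
at `x` of the algebroid is the tangent space at `1ₓ` of the source fiber of `x`, that is, the kernel
of the tangent map of `s` at `1ₓ`, and the anchor is the tangent map of `t`. If the groupoid is
regular, this is the tangent bundle of its orbit foliation. -/
noncomputable def anchorImage (x : M) : Submodule ℝ (Tan x) :=
  (LinearMap.ker (tanMap Γ.s (Γ.one x) (Γ.s_one x)).toLinearMap).map
    (tanMap Γ.t (Γ.one x) (Γ.t_one x)).toLinearMap

/-- Regular Lie groupoids: the anchor has locally constant rank. -/
structure IsRegular : Prop where
  lie : Γ.IsLie
  rank_locallyConstant : IsLocallyConstant (fun x : M => Module.finrank ℝ (Γ.anchorImage x))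

/-- Foliation groupoids: the fibers of `(s, t) : G → M × M` are discrete. -/
structure IsFoliation : Prop where
  lie : Γ.IsLie
  discrete : ∀ x y, DiscreteTopology {g : G | Γ.s g = x ∧ Γ.t g = y}

/-- Etale groupoids. -/
structure IsEtale : Prop where
  lie : Γ.IsLie
  s_etale : IsLocalDiffeo Γ.s
  t_etale : IsLocalDiffeo Γ.t

/-- Bundles of connected Lie groups: Lie groupoids with `s = t` and connected fibers. -/
structure IsConnectedBundle : Prop where
  lie : Γ.IsLie
  s_eq_t : Γ.s = Γ.t
  connected_fibers : ∀ x, IsConnected (Γ.s ⁻¹' {x})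

/-- `T` is an (embedded) submanifold of `M`, transversal to the orbit foliation and of dimension
equal to its codimension. -/
structure IsTransversal (T : Set M) [SmoothManifold T] : Prop where
  embedding : IsSmoothEmbedding (Subtype.val : T → M)
  isCompl : ∀ x : T, IsCompl (Γ.anchorImage (x : M))
    (LinearMap.range (tanMap (Subtype.val : T → M) x rfl).toLinearMap)

/-- For the Lie groupoid `G`, the homomorphism `p : G → H` exhibits `H` as the etale groupoid whose
arrows are the connected components of the source fibers of `G`. -/
structure IsEtaleComponents {H : Type w} [TopologicalSpace H] [SmoothManifold H]
    (Δ : GroupoidStr M H) (p : G → H) : Prop where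
  etale : Δ.IsEtale
  hom : Γ.IsHom Δ p
  factor : IsComponentFactorization Γ.s p Δ.s

end Lie

/-- The sequence `K → G → E` of Lie groupoids over `M`, with maps `j` and `π`, is an extension:
`j` is an embedding onto the kernel of `π`, and `π` is a surjective submersion. The last field says
that `E` is the quotient of `G` by the image of `K`. -/
structure IsExtension {M : Type u} [TopologicalSpace M] [SmoothManifold M]
    {K : Type v} [TopologicalSpace K] [SmoothManifold K]
    {G : Type v} [TopologicalSpace G] [SmoothManifold G]
    {E : Type v} [TopologicalSpace E] [SmoothManifold E]
    (κ : GroupoidStr M K) (Γ : GroupoidStr M G) (ε : GroupoidStr M E)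
    (j : K → G) (π : G → E) : Prop where
  hom_j : κ.IsHom Γ j
  embedding : IsSmoothEmbedding j
  hom_π : Γ.IsHom ε π
  submersion : IsSubmersion π
  surjective : Function.Surjective π
  exact : ∀ g, g ∈ range j ↔ π g ∈ range ε.one
  quotient : ∀ g h, π g = π h ↔ ∃ k, Γ.s g = Γ.t (j k) ∧ h = Γ.mul g (j k)

end GroupoidStr

end LieGpd

open LieGpd

/-!
Let `G` be a regular Lie groupoid over `M`. The kernel of the tangent map of `(s, t)` at an arrow
`g` is the kernel of `dt` on the tangent space of the source fiber. Right translation identifies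
the image of this restriction of `dt` with the image `F` of the anchor at `t g`
(`GroupoidStr.IsLie.map_ker_eq_anchorImage`), whose rank is locally constant. So `(s, t)` has
locally constant rank, and by the constant rank theorem (`exists_constantRank_coord`) it is locally
a coordinate projection followed by an injective map: `G` is covered by charts in which the fibers
of `(s, t)` are balls, called plaques (`GroupoidStr.IsRegular.exists_plaque_coord`). No Frobenius
theorem is needed.

Let `E` be the space of connected components of the fibers of `(s, t)`. A component is a chain of
plaques, so the quotient map `π : G → E` is open
(`GroupoidStr.IsRegular.isOpenMap_toComponent`), and a chart of `G` of the above form induces a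
chart of `E`, given by a smooth function of source and target. Hence transition maps are smooth,
`π` is a submersion, and `(s, t)` is locally injective on `E`, so its fibers are discrete. Left
translation shows that `π g = π h` if and only if `h = g k` for some `k` in the identity component
of an isotropy group. The units of `E` are the image of a section of `s`, thus a submanifold, and the
preimage of this submanifold under the submersion `π` is the union of the identity components.

For a transversal `T`, the freedom in the constant rank theorem is used: near an arrow of `E` from
`x` to `y` in `T` the chart may be chosen to consist of slice coordinates of `M` at the source and
of the normal part of slice coordinates at the target, because `F` is a complement of the tangent
space of `T` (`GroupoidStr.IsRegular.exists_transversal_chart`). There the arrows of `E` with source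
and target in `T` form a slice, and `s` identifies this slice with an open part of `T`. The
restriction of `G` is the preimage of this submanifold under `π`.

Charts of possibly different dimensions are handled through plots, the smooth maps from subsets
of normed spaces: smooth maps are those that preserve plots, submersions are those along which plots
lift, and a product is smooth if the product of composable plots is a plot.
-/

namespace LieGpd

/-! ### Plots -/

section Plots

variable {X : Type u} [TopologicalSpace X] [SmoothManifold X]
variable {Y : Type v} [TopologicalSpace Y] [SmoothManifold Y]
variable {V : Type*} [NormedAddCommGroup V] [NormedSpace ℝ V]
variable {W : Type*} [NormedAddCommGroup W] [NormedSpace ℝ W]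

/-- A plot at `v ∈ S`: the map `p` from the normed space `V` to the manifold `X` is continuous
within `S` at `v` and its expressions in the charts around `p v` are smooth within `S` at `v`.
The set `S` is arbitrary, so plots on submanifolds of `V` that are not open make sense. -/
structure PlotAt (p : V → X) (S : Set V) (v : V) : Prop where
  mem : v ∈ S
  cont : ContinuousWithinAt p S v
  smooth : ∀ {n : ℕ}, ∀ d ∈ SmoothManifold.charts (X := X) n, p v ∈ d.source →
    ContDiffWithinAt ℝ ∞ (fun w => d (p w)) S v

theorem transition_contDiffAt {n k : ℕ} {c : OpenPartialHomeomorph X (Euc n)}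
    {d : OpenPartialHomeomorph X (Euc k)} (hc : c ∈ SmoothManifold.charts n)
    (hd : d ∈ SmoothManifold.charts k) {x : X} (hxc : x ∈ c.source) (hxd : x ∈ d.source) :
    ContDiffAt ℝ ∞ (fun v => d (c.symm v)) (c x) := by
  refine (SmoothManifold.compatible c hc d hd).contDiffAt ?_
  refine (c.isOpen_inter_preimage_symm d.open_source).mem_nhds ⟨c.map_source hxc, ?_⟩
  simpa [c.left_inv hxc] using hxd

/-- It suffices to test a plot in a single chart. -/
theorem PlotAt.of_chart {p : V → X} {S : Set V} {v : V} {n : ℕ}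
    {c : OpenPartialHomeomorph X (Euc n)} (hc : c ∈ SmoothManifold.charts n) (hv : v ∈ S)
    (hcont : ContinuousWithinAt p S v) (hvc : p v ∈ c.source)
    (h : ContDiffWithinAt ℝ ∞ (fun w => c (p w)) S v) : PlotAt p S v := by
  refine ⟨hv, hcont, fun {k} d hd hvd => ?_⟩
  have h1 := (transition_contDiffAt hc hd hvc hvd).comp_contDiffWithinAt v h
  refine h1.congr_of_eventuallyEq ?_ (by simp [c.left_inv hvc])
  filter_upwards [hcont.preimage_mem_nhdsWithin (c.open_source.mem_nhds hvc)] with w hw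
  simp [c.left_inv hw]

theorem PlotAt.mono {p : V → X} {S S' : Set V} {v : V} (hp : PlotAt p S v) (h : S' ⊆ S)
    (hv : v ∈ S') : PlotAt p S' v :=
  ⟨hv, hp.cont.mono h, fun d hd hvd => (hp.smooth d hd hvd).mono h⟩

theorem PlotAt.congr {p q : V → X} {S : Set V} {v : V} (hp : PlotAt p S v)
    (h : q =ᶠ[𝓝[S] v] p) : PlotAt q S v := by
  have hv : q v = p v := h.eq_of_nhdsWithin hp.mem
  refine ⟨hp.mem, hp.cont.congr_of_eventuallyEq h hv, fun d hd hvd => ?_⟩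
  rw [hv] at hvd
  refine (hp.smooth d hd hvd).congr_of_eventuallyEq ?_ (by simp [hv])
  filter_upwards [h] with w hw
  simp [hw]

theorem PlotAt.of_inter {p : V → X} {S N : Set V} {v : V} (hp : PlotAt p (S ∩ N) v)
    (hN : N ∈ 𝓝[S] v) : PlotAt p S v := by
  have e : 𝓝[S] v ≤ 𝓝[S ∩ N] v := le_inf inf_le_left
    (Filter.le_principal_iff.2 (Filter.inter_mem self_mem_nhdsWithin hN))
  exact ⟨hp.mem.1, hp.cont.mono_left e, fun d hd hvd =>
    (hp.smooth d hd hvd).mono_of_mem_nhdsWithin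
      (Filter.inter_mem self_mem_nhdsWithin hN)⟩

theorem PlotAt.comp {p : V → X} {S : Set V} {g : W → V} {S' : Set W} {w : W}
    (hp : PlotAt p S (g w)) (hg : ContDiffWithinAt ℝ ∞ g S' w) (hw : w ∈ S')
    (hm : MapsTo g S' S) : PlotAt (fun w => p (g w)) S' w :=
  ⟨hw, hp.cont.comp hg.continuousWithinAt hm,
    fun d hd hvd => (hp.smooth d hd hvd).comp w hg hm⟩

theorem PlotAt.continuousAt {p : V → X} {v : V} (hp : PlotAt p univ v) : ContinuousAt p v :=
  continuousWithinAt_univ p v |>.1 hp.cont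

theorem plotAt_const (x : X) {S : Set V} {v : V} (hv : v ∈ S) :
    PlotAt (fun _ : V => x) S v :=
  ⟨hv, continuousWithinAt_const, fun _ _ _ => contDiffWithinAt_const⟩

theorem plotAt_chart_symm {n : ℕ} {c : OpenPartialHomeomorph X (Euc n)}
    (hc : c ∈ SmoothManifold.charts n) {v : Euc n} (hv : v ∈ c.target) :
    PlotAt c.symm univ v := by
  refine PlotAt.of_chart hc (mem_univ _) (c.continuousAt_symm hv).continuousWithinAt
    (c.map_target hv) ?_
  refine contDiffWithinAt_id.congr_of_eventuallyEq ?_ (c.right_inv hv)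
  rw [nhdsWithin_univ]
  exact c.eventually_right_inverse hv

theorem SmoothOn.plotAt {f : X → Y} {U : Set X} (hU : IsOpen U) (hf : SmoothOn f U)
    {p : V → X} {S : Set V} {v : V} (hp : PlotAt p S v) (hv : p v ∈ U) :
    PlotAt (fun w => f (p w)) S v := by
  set c := chartNear (p v)
  have hc : c ∈ SmoothManifold.charts _ := chartNear_mem (p v)
  have hvc : p v ∈ c.source := mem_chartNear_source (p v)
  set d := chartNear (f (p v))
  have hd : d ∈ SmoothManifold.charts _ := chartNear_mem (f (p v))
  have hvd : f (p v) ∈ d.source := mem_chartNear_source _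
  have hfc : ContinuousAt f (p v) := hf.1.continuousAt (hU.mem_nhds hv)
  have hcont : ContinuousWithinAt (fun w => f (p w)) S v :=
    hfc.comp_continuousWithinAt hp.cont
  refine PlotAt.of_chart hd hp.mem hcont hvd ?_
  have h1 := hf.2 _ _ c hc d hd
  have h2 : ContDiffWithinAt ℝ ∞ (fun w => c (p w)) S v := hp.smooth c hc hvc
  have hev : ∀ᶠ w in 𝓝[S] v, p w ∈ c.source ∩ U ∧ f (p w) ∈ d.source :=
    ((hp.cont.eventually (c.open_source.mem_nhds hvc)).and
      (hp.cont.eventually (hU.mem_nhds hv))).and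
      (hcont.eventually (d.open_source.mem_nhds hvd))
  have h3 := (h1 (c (p v)) ⟨c.map_source hvc, by rwa [c.left_inv hvc],
    by rwa [c.left_inv hvc]⟩).comp_of_mem_nhdsWithin_image v h2 ?_
  · refine h3.congr_of_eventuallyEq ?_ ?_
    · filter_upwards [hev] with w hw
      simp [c.left_inv hw.1.1]
    · simp [c.left_inv hvc]
  · have h4 : {x | x ∈ c.target ∧ c.symm x ∈ U ∧ f (c.symm x) ∈ d.source} ∈ 𝓝 (c (p v)) := by
      have hcs : ContinuousAt c.symm (c (p v)) := c.continuousAt_symm (c.map_source hvc)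
      have e : c.symm (c (p v)) = p v := c.left_inv hvc
      refine Filter.inter_mem (c.open_target.mem_nhds (c.map_source hvc))
        (Filter.inter_mem (hcs (by rw [e]; exact hU.mem_nhds hv)) ?_)
      refine (ContinuousAt.comp (g := f) (f := c.symm) (by rwa [e]) hcs) ?_
      simp only [Function.comp, e]
      exact d.open_source.mem_nhds hvd
    exact mem_nhdsWithin_of_mem_nhds h4

theorem Smooth.plotAt {f : X → Y} (hf : Smooth f) {p : V → X} {S : Set V} {v : V}
    (hp : PlotAt p S v) : PlotAt (fun w => f (p w)) S v :=
  SmoothOn.plotAt isOpen_univ hf hp (mem_univ _)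

/-- A map that preserves plots is smooth; it suffices to consider plots defined near a point. -/
theorem smoothOn_of_plots {f : X → Y} {U : Set X}
    (h : ∀ (n : ℕ) (p : Euc n → X) (v : Euc n), PlotAt p univ v → p v ∈ U →
      PlotAt (fun w => f (p w)) univ v) : SmoothOn f U := by
  refine ⟨fun x hx => ?_, fun n k c hc d hd v hv => ?_⟩
  · set c := chartNear x
    have hxc : x ∈ c.source := mem_chartNear_source x
    have h1 := (h _ c.symm (c x) (plotAt_chart_symm (chartNear_mem x) (c.map_source hxc))
      (by rwa [c.left_inv hxc])).continuousAt
    have h2 : ContinuousAt (fun y => f (c.symm (c y))) x :=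
      ContinuousAt.comp (g := fun w => f (c.symm w)) h1 (c.continuousAt hxc)
    refine (h2.congr ?_).continuousWithinAt
    filter_upwards [c.open_source.mem_nhds hxc] with y hy
    rw [c.left_inv hy]
  · exact ((h _ c.symm v (plotAt_chart_symm hc hv.1) hv.2.1).smooth d hd hv.2.2).mono
      (subset_univ _)

theorem smooth_of_plots {f : X → Y}
    (h : ∀ (n : ℕ) (p : Euc n → X) (v : Euc n), PlotAt p univ v →
      PlotAt (fun w => f (p w)) univ v) : Smooth f :=
  smoothOn_of_plots fun n p v hp _ => h n p v hp

theorem Smooth.continuous {f : X → Y} (hf : Smooth f) : Continuous f :=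
  continuousOn_univ.1 hf.1

/-! ### Smooth functions with values in normed spaces and their derivatives -/

/-- The vector valued function `a` is smooth at the point `x` of the manifold `X`, as a function of
the preferred chart around `x`. -/
def SmAt (a : X → W) (x : X) : Prop :=
  ContDiffAt ℝ ∞ (fun v => a ((chartNear x).symm v)) (chartNear x x)

/-- The derivative at `x` of a vector valued function on a manifold, on the tangent space given by
the preferred chart. -/
noncomputable def dAt (a : X → W) (x : X) : Tan x →L[ℝ] W :=
  fderiv ℝ (fun v => a ((chartNear x).symm v)) (chartNear x x)

theorem SmAt.comp_plot {a : X → W} {p : V → X} {S : Set V} {v : V} (ha : SmAt a (p v))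
    (hp : PlotAt p S v) : ContDiffWithinAt ℝ ∞ (fun w => a (p w)) S v := by
  set c := chartNear (p v) with hc
  have hvc : p v ∈ c.source := mem_chartNear_source (p v)
  have h := ContDiffAt.comp_contDiffWithinAt v (g := fun w => a (c.symm w))
    (f := fun w => c (p w)) ha (hp.smooth c (chartNear_mem _) hvc)
  refine h.congr_of_eventuallyEq ?_ (by simp [c.left_inv hvc])
  filter_upwards [hp.cont.eventually (c.open_source.mem_nhds hvc)] with w hw
  simp [c.left_inv hw]

theorem SmAt.of_plots {a : X → W} {x : X}
    (h : ∀ (n : ℕ) (p : Euc n → X) (v : Euc n), PlotAt p univ v → p v = x →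
      ContDiffAt ℝ ∞ (fun w => a (p w)) v) : SmAt a x :=
  h _ _ _ (plotAt_chart_symm (chartNear_mem x)
    ((chartNear x).map_source (mem_chartNear_source x)))
    ((chartNear x).left_inv (mem_chartNear_source x))

theorem SmAt.comp_plot_univ {a : X → W} {p : V → X} {v : V} {x : X} (ha : SmAt a x)
    (hp : PlotAt p univ v) (hx : p v = x) : ContDiffAt ℝ ∞ (fun w => a (p w)) v := by
  subst hx
  exact contDiffWithinAt_univ.1 (ha.comp_plot hp)

theorem SmAt.comp {a : Y → W} {f : X → Y} {x : X} (ha : SmAt a (f x)) (hf : Smooth f) :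
    SmAt (fun z => a (f z)) x :=
  SmAt.of_plots fun _ p _ hp hx =>
    ha.comp_plot_univ (p := fun w => f (p w)) (hf.plotAt hp) (by rw [hx])

theorem SmAt.post {a : X → V} {x : X} {g : V → W} (ha : SmAt a x)
    (hg : ContDiffAt ℝ ∞ g (a x)) : SmAt (fun z => g (a z)) x :=
  SmAt.of_plots fun _ p _ hp hx =>
    ContDiffAt.comp (g := g) (f := fun w => a (p w)) _ (by rwa [hx])
      (ha.comp_plot_univ hp hx)

theorem SmAt.prodMk {a : X → V} {b : X → W} {x : X} (ha : SmAt a x) (hb : SmAt b x) :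
    SmAt (fun z => (a z, b z)) x :=
  ContDiffAt.prodMk (f := fun v => a ((chartNear x).symm v)) ha hb

theorem smAt_chart {n : ℕ} {c : OpenPartialHomeomorph X (Euc n)}
    (hc : c ∈ SmoothManifold.charts n) {x : X} (hx : x ∈ c.source) : SmAt c x :=
  SmAt.of_plots fun _ p _ hp e =>
    contDiffWithinAt_univ.1 (hp.smooth c hc (by rwa [e]))

theorem SmAt.continuousAt {a : X → W} {x : X} (ha : SmAt a x) : ContinuousAt a x := by
  set c := chartNear x
  have hx : x ∈ c.source := mem_chartNear_source x
  have h : ContinuousAt (fun y => a (c.symm (c y))) x :=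
    ContinuousAt.comp (g := fun w => a (c.symm w)) (ContDiffAt.continuousAt ha)
      (c.continuousAt hx)
  refine h.congr ?_
  filter_upwards [c.open_source.mem_nhds hx] with y hy
  rw [c.left_inv hy]

theorem SmAt.hasFDerivAt {a : X → W} {x : X} (ha : SmAt a x) :
    HasFDerivAt (fun v => a ((chartNear x).symm v)) (dAt a x) (chartNear x x) :=
  (ContDiffAt.differentiableAt ha (by simp)).hasFDerivAt

/-- The plot `p` passes through `x` at `v`, with derivative `A` there. -/
structure HasVel (p : V → X) (v : V) (x : X) (A : V →L[ℝ] Tan x) : Prop where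
  eq : p v = x
  cont : ContinuousAt p v
  deriv : HasFDerivAt (fun w => chartNear x (p w)) A v

theorem PlotAt.hasVel {p : V → X} {v : V} {x : X} (hp : PlotAt p univ v) (hx : p v = x) :
    HasVel p v x (fderiv ℝ (fun w => chartNear x (p w)) v) :=
  ⟨hx, hp.continuousAt, ((contDiffWithinAt_univ.1 (hp.smooth _ (chartNear_mem x)
    (by rw [hx]; exact mem_chartNear_source x))).differentiableAt (by simp)).hasFDerivAt⟩

/-- The chain rule for a function after a plot. -/
theorem HasVel.comp_smAt {p : V → X} {v : V} {x : X} {A : V →L[ℝ] Tan x}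
    (hp : HasVel p v x A) {a : X → W} (ha : SmAt a x) :
    HasFDerivAt (fun w => a (p w)) (dAt a x ∘L A) v := by
  set c := chartNear x
  have hx : p v ∈ c.source := by rw [hp.eq]; exact mem_chartNear_source x
  have h := HasFDerivAt.comp (g := fun w => a (c.symm w)) (f := fun w => c (p w)) v
    (by simpa [c, hp.eq] using ha.hasFDerivAt) hp.deriv
  refine h.congr_of_eventuallyEq ?_
  filter_upwards [hp.cont.eventually (c.open_source.mem_nhds hx)] with w hw
  simp [c.left_inv hw]

theorem smAt_chart_comp {f : X → Y} (hf : Smooth f) {x : X} {y : Y} (h : f x = y) :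
    SmAt (fun z => chartNear y (f z)) x := by
  subst h
  exact SmAt.comp (smAt_chart (chartNear_mem _) (mem_chartNear_source _)) hf

theorem HasVel.comp_smooth {p : V → X} {v : V} {x : X} {A : V →L[ℝ] Tan x}
    (hp : HasVel p v x A) {f : X → Y} (hf : Smooth f) {y : Y} (h : f x = y) :
    HasVel (fun w => f (p w)) v y (tanMap f x h ∘L A) :=
  ⟨by rw [hp.eq, h], hf.continuous.continuousAt.comp hp.cont,
    hp.comp_smAt (smAt_chart_comp hf h)⟩

theorem HasVel.unique {p q : V → X} {v : V} {x : X} {A B : V →L[ℝ] Tan x}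
    (hp : HasVel p v x A) (hq : HasVel q v x B) (h : p =ᶠ[𝓝 v] q) : A = B := by
  refine hp.deriv.unique (hq.deriv.congr_of_eventuallyEq ?_)
  filter_upwards [h] with w hw
  simp [hw]

theorem hasVel_chartNear_symm (x : X) :
    HasVel (chartNear x).symm (chartNear x x) x (ContinuousLinearMap.id ℝ _) := by
  have hx := mem_chartNear_source x
  refine ⟨(chartNear x).left_inv hx, (chartNear x).continuousAt_symm
    ((chartNear x).map_source hx), ?_⟩
  refine (hasFDerivAt_id _).congr_of_eventuallyEq ?_
  exact (chartNear x).eventually_right_inverse ((chartNear x).map_source hx)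

/-- The chain rule for a function after a smooth map. -/
theorem dAt_comp {f : X → Y} (hf : Smooth f) {x : X} {y : Y} (h : f x = y) {a : Y → W}
    (ha : SmAt a y) (u : Tan x) : dAt (fun z => a (f z)) x u = dAt a y (tanMap f x h u) := by
  have h1 := ((hasVel_chartNear_symm x).comp_smooth hf h).comp_smAt ha
  have h2 : dAt (fun z => a (f z)) x = _ := h1.fderiv
  rw [h2]
  rfl

theorem dAt_post {a : X → V} {x : X} (ha : SmAt a x) (φ : V →L[ℝ] W) (u : Tan x) :
    dAt (fun z => φ (a z)) x u = φ (dAt a x u) := by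
  have h2 : dAt (fun z => φ (a z)) x = _ := (φ.hasFDerivAt.comp _ ha.hasFDerivAt).fderiv
  rw [h2]
  rfl

theorem dAt_prodMk {a : X → V} {b : X → W} {x : X} (ha : SmAt a x) (hb : SmAt b x)
    (u : Tan x) : dAt (fun z => (a z, b z)) x u = (dAt a x u, dAt b x u) := by
  have h2 : dAt (fun z => (a z, b z)) x = _ := (ha.hasFDerivAt.prodMk hb.hasFDerivAt).fderiv
  rw [h2]
  rfl

/-! ### Smooth coordinates -/

/-- A local homeomorphism from a manifold to a normed space is a smooth coordinate system if it
and its inverse are smooth. -/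
structure IsCoord (c : OpenPartialHomeomorph X W) : Prop where
  smAt : ∀ x ∈ c.source, SmAt c x
  plotAt : ∀ v ∈ c.target, PlotAt c.symm univ v

theorem isCoord_chart {n : ℕ} {c : OpenPartialHomeomorph X (Euc n)}
    (hc : c ∈ SmoothManifold.charts n) : IsCoord c :=
  ⟨fun _ hx => smAt_chart hc hx, fun _ hv => plotAt_chart_symm hc hv⟩

theorem PlotAt.of_coord {c : OpenPartialHomeomorph X W} (hc : IsCoord c) {p : V → X}
    {S : Set V} {v : V} (hv : v ∈ S) (hcont : ContinuousWithinAt p S v)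
    (hvc : p v ∈ c.source) (h : ContDiffWithinAt ℝ ∞ (fun w => c (p w)) S v) :
    PlotAt p S v := by
  have hev : ∀ᶠ w in 𝓝[S] v, p w ∈ c.source :=
    hcont.eventually (c.open_source.mem_nhds hvc)
  have h1 := (hc.plotAt (c (p v)) (c.map_source hvc)).comp (w := v) (g := fun w => c (p w)) h hv
    (mapsTo_univ _ _)
  refine h1.congr ?_
  filter_upwards [hev] with w hw
  simp [c.left_inv hw]

theorem IsCoord.plotAt_symm {c : OpenPartialHomeomorph X W} (hc : IsCoord c) {g : V → W}
    {S : Set V} {v : V} (hg : ContDiffWithinAt ℝ ∞ g S v) (hv : v ∈ S) (h : g v ∈ c.target) :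
    PlotAt (fun w => c.symm (g w)) S v :=
  (hc.plotAt (g v) h).comp hg hv (mapsTo_univ _ _)

theorem IsCoord.dAt_injective {c : OpenPartialHomeomorph X W} (hc : IsCoord c) {x : X}
    (hx : x ∈ c.source) : Function.Injective (dAt c x) := by
  -- `chartNear x = (chartNear x ∘ c⁻¹) ∘ c` near `x`
  have h1 := (hc.plotAt (c x) (c.map_source hx)).hasVel (x := x) (c.left_inv hx)
  set B := fderiv ℝ (fun w => chartNear x (c.symm w)) (c x)
  have h2 := (hasVel_chartNear_symm x).comp_smAt (hc.smAt x hx)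
  have hxx := mem_chartNear_source x
  have e : (chartNear x).symm (chartNear x x) = x := (chartNear x).left_inv hxx
  have h3 := HasFDerivAt.comp (chartNear x x) (g := fun w => chartNear x (c.symm w))
    (by simpa only [e] using h1.deriv) h2
  have h4 : HasFDerivAt (fun w => w) (B ∘L (dAt c x ∘L ContinuousLinearMap.id ℝ _))
      (chartNear x x) := by
    refine h3.congr_of_eventuallyEq ?_
    have t : ContinuousAt (chartNear x).symm (chartNear x x) :=
      (chartNear x).continuousAt_symm ((chartNear x).map_source hxx)
    filter_upwards [(chartNear x).open_target.mem_nhds ((chartNear x).map_source hxx),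
      t.eventually (p := fun y => y ∈ c.source) (by rw [e]; exact c.open_source.mem_nhds hx)]
      with w hw hw'
    simp [c.left_inv hw', (chartNear x).right_inv hw]
  have h5 := h4.unique (hasFDerivAt_id _)
  intro a b hab
  have ha := DFunLike.congr_fun h5 a
  have hb := DFunLike.congr_fun h5 b
  simp only [ContinuousLinearMap.comp_id, ContinuousLinearMap.comp_apply,
    ContinuousLinearMap.id_apply] at ha hb
  rw [← ha, ← hb, hab]

/-- The derivative of the inverse of a smooth coordinate system is inverse to its derivative. -/
theorem IsCoord.dAt_vel {c : OpenPartialHomeomorph X W} (hc : IsCoord c) {v : W}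
    (hv : v ∈ c.target) {x : X} {A : W →L[ℝ] Tan x} (hA : HasVel c.symm v x A)
    (w : W) : dAt c x (A w) = w := by
  have h1 := hA.comp_smAt (hc.smAt _ (hA.eq ▸ c.map_target hv))
  have h2 := ((hasFDerivAt_id (𝕜 := ℝ) v).congr_of_eventuallyEq
    (c.eventually_right_inverse hv)).unique h1
  exact (DFunLike.congr_fun h2 w).symm

theorem IsCoord.dAt_surjective {c : OpenPartialHomeomorph X W} (hc : IsCoord c) {x : X}
    (hx : x ∈ c.source) : Function.Surjective (dAt c x) := fun w =>
  ⟨_, hc.dAt_vel (c.map_source hx)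
    ((hc.plotAt (c x) (c.map_source hx)).hasVel (x := x) (c.left_inv hx)) w⟩

theorem IsCoord.finrank_eq {c : OpenPartialHomeomorph X W} (hc : IsCoord c) {x : X}
    (hx : x ∈ c.source) : Module.finrank ℝ W = dimAt x := by
  have := (LinearEquiv.ofBijective (dAt c x).toLinearMap
    ⟨hc.dAt_injective hx, hc.dAt_surjective hx⟩).finrank_eq
  rw [← this]
  simp

theorem dimAt_eventually_eq (x : X) : ∀ᶠ y in 𝓝 x, dimAt y = dimAt x := by
  filter_upwards [(chartNear x).open_source.mem_nhds (mem_chartNear_source x)] with y hy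
  rw [← (isCoord_chart (chartNear_mem x)).finrank_eq hy]
  simp

theorem IsCoord.restr {c : OpenPartialHomeomorph X W} (hc : IsCoord c) {U : Set X}
    (hU : IsOpen U) : IsCoord (c.restrOpen U hU) :=
  ⟨fun x hx => hc.smAt x hx.1, fun v hv => hc.plotAt v hv.1⟩

theorem IsCoord.trans {c : OpenPartialHomeomorph X W} (hc : IsCoord c)
    {Ψ : OpenPartialHomeomorph W V} (h1 : ∀ w ∈ Ψ.source, ContDiffAt ℝ ∞ Ψ w)
    (h2 : ∀ v ∈ Ψ.target, ContDiffAt ℝ ∞ Ψ.symm v) : IsCoord (c.trans Ψ) := by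
  refine ⟨fun x hx => ?_, fun v hv => ?_⟩
  · simp only [OpenPartialHomeomorph.trans_source, mem_inter_iff, mem_preimage] at hx
    exact (hc.smAt x hx.1).post (h1 _ hx.2)
  · simp only [OpenPartialHomeomorph.trans_target, mem_inter_iff, mem_preimage] at hv
    exact (hc.plotAt _ hv.2).comp (h2 v hv.1).contDiffWithinAt (mem_univ _) (mapsTo_univ _ _)

end Plots

/-! ### Consequences of the inverse function theorem -/

section InverseFunction

variable {X : Type u} [TopologicalSpace X] [SmoothManifold X]
variable {Y : Type v} [TopologicalSpace Y] [SmoothManifold Y]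
variable {V : Type*} [NormedAddCommGroup V] [NormedSpace ℝ V]
variable {W : Type*} [NormedAddCommGroup W] [NormedSpace ℝ W]

theorem dAt_congr {a b : X → W} {x : X} (h : b =ᶠ[𝓝 x] a) : dAt b x = dAt a x := by
  refine Filter.EventuallyEq.fderiv_eq ?_
  have hx := mem_chartNear_source x
  have t : ContinuousAt (chartNear x).symm (chartNear x x) :=
    (chartNear x).continuousAt_symm ((chartNear x).map_source hx)
  exact t.eventually (p := fun y => b y = a y) (by rw [(chartNear x).left_inv hx]; exact h)

theorem dAt_chartNear (x : X) (u : Tan x) : dAt (chartNear x) x u = u := by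
  have h : dAt (chartNear x) x = _ := (hasVel_chartNear_symm x).deriv.fderiv
  rw [h]
  rfl

/-- The inverse function theorem, with a local inverse that is smooth on its whole domain. -/
theorem exists_localDiffeo [FiniteDimensional ℝ V] [FiniteDimensional ℝ W] {h : V → W} {p : V}
    {O : Set V} (hO : O ∈ 𝓝 p) (hs : ∀ᶠ v in 𝓝 p, ContDiffAt ℝ ∞ h v)
    (hb : Function.Bijective (fderiv ℝ h p)) :
    ∃ Ψ : OpenPartialHomeomorph V W, p ∈ Ψ.source ∧ Ψ.source ⊆ O ∧ (∀ v, Ψ v = h v) ∧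
      (∀ v ∈ Ψ.source, ContDiffAt ℝ ∞ Ψ v) ∧ ∀ w ∈ Ψ.target, ContDiffAt ℝ ∞ Ψ.symm w := by
  have := FiniteDimensional.complete ℝ V
  have := FiniteDimensional.complete ℝ W
  have hp : ContDiffAt ℝ ∞ h p := hs.self_of_nhds
  let L : V ≃L[ℝ] W :=
    (LinearEquiv.ofBijective (fderiv ℝ h p).toLinearMap hb).toContinuousLinearEquiv
  have hL : (L : V →L[ℝ] W) = fderiv ℝ h p := by
    ext v
    rfl
  have hd : HasFDerivAt h (L : V →L[ℝ] W) p := by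
    rw [hL]
    exact (hp.differentiableAt (by simp)).hasFDerivAt
  let Ψ₀ := hp.toOpenPartialHomeomorph h hd (by simp)
  -- the derivative stays invertible near `p`
  have hinv : ∀ᶠ v in 𝓝 p, fderiv ℝ h v ∈ range ((↑) : (V ≃L[ℝ] W) → V →L[ℝ] W) := by
    have hc : ContinuousAt (fderiv ℝ h) p :=
      (hp.fderiv_right (m := 0) (by simp)).continuousAt
    exact hc.eventually (ContinuousLinearEquiv.nhds L |> fun t => by rwa [hL] at t)
  obtain ⟨U, hU, hUo, hpU⟩ := mem_nhds_iff.1 ((hs.and hinv).and hO)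
  refine ⟨Ψ₀.restrOpen U hUo, ⟨hp.mem_toOpenPartialHomeomorph_source hd (by simp), hpU⟩,
    fun v hv => (hU hv.2).2, fun v => rfl, fun v hv => (hU hv.2).1.1, fun w hw => ?_⟩
  have hw' : Ψ₀.symm w ∈ U := ((Ψ₀.restrOpen U hUo).map_target hw).2
  obtain ⟨L', hL'⟩ := (hU hw').1.2
  refine Ψ₀.contDiffAt_symm (f₀' := L') hw.1 ?_ (hU hw').1.1
  rw [hL']
  exact ((hU hw').1.1.differentiableAt (by simp)).hasFDerivAt

/-- Functions on a manifold with bijective derivative are local coordinates. -/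
theorem exists_isCoord [FiniteDimensional ℝ W] {a : X → W} {x₀ : X} {O : Set X} (hO : O ∈ 𝓝 x₀)
    (hs : ∀ᶠ x in 𝓝 x₀, SmAt a x) (hb : Function.Bijective (dAt a x₀)) :
    ∃ c : OpenPartialHomeomorph X W, IsCoord c ∧ x₀ ∈ c.source ∧ c.source ⊆ O ∧
      ∀ x ∈ c.source, c x = a x := by
  set e := chartNear x₀ with he
  have hx₀ : x₀ ∈ e.source := mem_chartNear_source x₀
  have hes : Filter.Tendsto e.symm (𝓝 (e x₀)) (𝓝 x₀) := by
    have := e.continuousAt_symm (e.map_source hx₀)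
    rwa [ContinuousAt, e.left_inv hx₀] at this
  have het : e.target ∈ 𝓝 (e x₀) := e.open_target.mem_nhds (e.map_source hx₀)
  obtain ⟨Ψ, h1, h2, h3, h4, h5⟩ := exists_localDiffeo (h := fun v => a (e.symm v)) (p := e x₀)
    (O := e.target ∩ e.symm ⁻¹' O) (Filter.inter_mem het (hes hO))
    (by
      filter_upwards [het, hes.eventually hs] with v hv hv'
      exact hv'.comp_plot_univ (plotAt_chart_symm (chartNear_mem x₀) hv) rfl) hb
  refine ⟨e.trans Ψ, (isCoord_chart (chartNear_mem x₀)).trans h4 h5, ?_, ?_, ?_⟩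
  · simp [hx₀, h1]
  · intro x hx
    simp only [OpenPartialHomeomorph.trans_source, mem_inter_iff, mem_preimage] at hx
    have := (h2 hx.2).2
    rwa [mem_preimage, e.left_inv hx.1] at this
  · intro x hx
    simp only [OpenPartialHomeomorph.trans_source, mem_inter_iff, mem_preimage] at hx
    simp [h3, e.left_inv hx.1]

/-- A submersive vector valued function is the first component of a local coordinate system, whose
image may be taken to be a product of balls. -/
theorem exists_submersion_coord [FiniteDimensional ℝ W] {a : X → W} {x₀ : X} {O : Set X}
    (hO : O ∈ 𝓝 x₀) (hs : ∀ᶠ x in 𝓝 x₀, SmAt a x) (hb : Function.Surjective (dAt a x₀)) :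
    ∃ (c : OpenPartialHomeomorph X (W × LinearMap.ker (dAt a x₀).toLinearMap)) (r : ℝ), 0 < r ∧
      IsCoord c ∧ x₀ ∈ c.source ∧ c.source ⊆ O ∧ (∀ x ∈ c.source, (c x).1 = a x) ∧
      c.target = Metric.ball (c x₀).1 r ×ˢ Metric.ball (c x₀).2 r := by
  set Z := LinearMap.ker (dAt a x₀).toLinearMap
  obtain ⟨P₀, hP₀⟩ := LinearMap.exists_leftInverse_of_injective Z.subtype Z.ker_subtype
  let P : Tan x₀ →L[ℝ] Z := LinearMap.toContinuousLinearMap P₀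
  have hP : ∀ z : Z, P z = z := fun z => DFunLike.congr_fun hP₀ z
  have hsx : SmAt a x₀ := hs.self_of_nhds
  have hsc : ∀ᶠ x in 𝓝 x₀, SmAt (fun x => P (chartNear x₀ x)) x := by
    filter_upwards [(chartNear x₀).open_source.mem_nhds (mem_chartNear_source x₀)] with x hx
    exact (smAt_chart (chartNear_mem x₀) hx).post P.contDiff.contDiffAt
  have hd : ∀ u, dAt (fun x => (a x, P (chartNear x₀ x))) x₀ u = (dAt a x₀ u, P u) := by
    intro u
    rw [dAt_prodMk hsx hsc.self_of_nhds,
      dAt_post (smAt_chart (chartNear_mem x₀) (mem_chartNear_source x₀)), dAt_chartNear]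
  obtain ⟨c, hc, hx, hcO, hca⟩ := exists_isCoord (a := fun x => (a x, P (chartNear x₀ x))) hO
    (hs.and hsc |>.mono fun x h => h.1.prodMk h.2) (by
      constructor
      · rw [injective_iff_map_eq_zero]
        intro u hu
        rw [hd, Prod.mk_eq_zero] at hu
        exact congrArg Subtype.val ((hP ⟨u, hu.1⟩).symm.trans hu.2)
      · rintro ⟨w, z⟩
        obtain ⟨u, hu⟩ := hb w
        refine ⟨u + (z - P u : Z), ?_⟩
        rw [hd]
        have hz : dAt a x₀ ((z - P u : Z) : Tan x₀) = 0 := (z - P u).2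
        rw [map_add, map_add, hz, hP, hu]
        simp)
  obtain ⟨r, hr, hrt⟩ := Metric.mem_nhds_iff.1 (c.open_target.mem_nhds (c.map_source hx))
  rw [← ball_prod_same (c x₀).1 (c x₀).2 r] at hrt
  set B := Metric.ball (c x₀).1 r ×ˢ Metric.ball (c x₀).2 r
  have hB : IsOpen B := Metric.isOpen_ball.prod Metric.isOpen_ball
  refine ⟨(c.symm.restrOpen B hB).symm, r, hr, ⟨fun x hx => ?_, fun v hv => ?_⟩, ?_, ?_, ?_, ?_⟩
  · exact hc.smAt x hx.1
  · exact hc.plotAt v hv.1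
  · exact ⟨hx, Metric.mem_ball_self hr, Metric.mem_ball_self hr⟩
  · exact fun x hx => hcO hx.1
  · exact fun x hx => congrArg Prod.fst (hca x hx.1)
  · exact inter_eq_right.2 hrt

/-- The constant rank theorem: if the rank of the derivative of `f` is constant and `φ` is
injective on the range of the derivative at `x₀`, then `f` is locally a function
of `φ ∘ f`. -/
theorem exists_constantRank_coord [FiniteDimensional ℝ V] [FiniteDimensional ℝ W] {f : X → V}
    {φ : V →L[ℝ] W} {x₀ : X} {O : Set X} (hO : O ∈ 𝓝 x₀) (hs : ∀ᶠ x in 𝓝 x₀, SmAt f x)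
    (hrank : ∀ᶠ x in 𝓝 x₀, Module.finrank ℝ (LinearMap.ker (dAt f x).toLinearMap) =
      Module.finrank ℝ (LinearMap.ker (dAt f x₀).toLinearMap))
    (hsurj : ∀ w, ∃ u, φ (dAt f x₀ u) = w) (hker : ∀ u, φ (dAt f x₀ u) = 0 → dAt f x₀ u = 0) :
    ∃ (Z : Submodule ℝ (Tan x₀)) (c : OpenPartialHomeomorph X (W × Z)) (r : ℝ), 0 < r ∧
      IsCoord c ∧ x₀ ∈ c.source ∧ c.source ⊆ O ∧ (∀ x ∈ c.source, (c x).1 = φ (f x)) ∧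
      c.target = Metric.ball (c x₀).1 r ×ˢ Metric.ball (c x₀).2 r ∧
      ∀ x ∈ c.source, ∀ y ∈ c.source, φ (f x) = φ (f y) → f x = f y := by
  have hsx : SmAt f x₀ := hs.self_of_nhds
  have hd : ∀ {x}, SmAt f x → ∀ u, dAt (fun x => φ (f x)) x u = φ (dAt f x u) :=
    fun h u => dAt_post h φ u
  obtain ⟨c, r, hr, hc, hx, hcO, hca, hct⟩ := exists_submersion_coord (a := fun x => φ (f x))
    (x₀ := x₀) (Filter.inter_mem hO ((hs.and hrank).and (dimAt_eventually_eq x₀)))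
    (hs.mono fun x h => h.post φ.contDiff.contDiffAt) (by
      intro w
      obtain ⟨u, hu⟩ := hsurj w
      exact ⟨u, by rw [hd hsx, hu]⟩)
  refine ⟨_, c, r, hr, hc, hx, fun x hx => (hcO hx).1, hca, hct, ?_⟩
  -- the kernels of the derivatives of `f` and of `φ ∘ f` agree, because they do so at `x₀`
  have hkeq : ∀ x ∈ c.source, ∀ u, φ (dAt f x u) = 0 → dAt f x u = 0 := by
    have hdim : ∀ x ∈ c.source, Module.finrank ℝ
        (LinearMap.ker (dAt (fun x => φ (f x)) x).toLinearMap) + Module.finrank ℝ W =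
          dimAt x := by
      intro x hx
      have hsj : Function.Surjective (dAt (fun x => φ (f x)) x) := by
        intro w
        obtain ⟨u, hu⟩ := hc.dAt_surjective hx (w, 0)
        refine ⟨u, ?_⟩
        rw [← dAt_congr (a := fun x => φ (f x)) (b := fun x => ContinuousLinearMap.fst ℝ W _ (c x))
          (Filter.eventually_of_mem (c.open_source.mem_nhds hx) hca),
          dAt_post (hc.smAt x hx), hu]
        rfl
      have h := LinearMap.finrank_range_add_finrank_ker
        (dAt (fun x => φ (f x)) x).toLinearMap
      rw [LinearMap.range_eq_top.2 hsj, finrank_top] at h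
      rw [add_comm, h]
      simp
    have hle : ∀ x ∈ c.source, LinearMap.ker (dAt f x).toLinearMap ≤
        LinearMap.ker (dAt (fun x => φ (f x)) x).toLinearMap := by
      intro x hx u hu
      have hu' : dAt f x u = 0 := hu
      change dAt (fun x => φ (f x)) x u = 0
      rw [hd (hcO hx).2.1.1, hu', map_zero]
    have h0 : LinearMap.ker (dAt f x₀).toLinearMap =
        LinearMap.ker (dAt (fun x => φ (f x)) x₀).toLinearMap := by
      refine le_antisymm (hle x₀ hx) fun u hu => ?_
      have hu' : dAt (fun x => φ (f x)) x₀ u = 0 := hu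
      rw [hd hsx] at hu'
      exact hker u hu'
    intro x hxc u hu
    have h1 := hdim x hxc
    have h2 := hdim x₀ hx
    have h3 : Module.finrank ℝ (LinearMap.ker (dAt f x).toLinearMap) =
      Module.finrank ℝ (LinearMap.ker (dAt f x₀).toLinearMap) := (hcO hxc).2.1.2
    have h4 : dimAt x = dimAt x₀ := (hcO hxc).2.2
    rw [← h0] at h2
    have h5 := Submodule.eq_of_le_of_finrank_eq (hle x hxc) (by omega)
    have h6 : u ∈ LinearMap.ker (dAt (fun x => φ (f x)) x).toLinearMap := by
      change dAt (fun x => φ (f x)) x u = 0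
      rw [hd (hcO hxc).2.1.1, hu]
    rw [← h5] at h6
    exact h6
  intro x hxc y hyc hxy
  have hcx := c.map_source hxc
  have hcy := c.map_source hyc
  have e1 : (c x).1 = (c y).1 := by rw [hca x hxc, hca y hyc, hxy]
  rw [hct] at hcx hcy
  set b := (c x).1
  -- on the plaque with first coordinate `b`, the derivative of `f` vanishes
  have hder : ∀ z ∈ Metric.ball (c x₀).2 r,
      HasFDerivAt (fun z => f (c.symm (b, z))) (0 : _ →L[ℝ] V) z := by
    intro z hz
    have hv : (b, z) ∈ c.target := by
      rw [hct]
      exact ⟨hcx.1, hz⟩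
    have hvel := (hc.plotAt _ hv).hasVel (x := c.symm (b, z)) rfl
    have hcs := c.map_target hv
    have h1 := hvel.comp_smAt (hcO hcs).2.1.1
    have h2 : HasFDerivAt (fun z : LinearMap.ker (dAt (fun x => φ (f x)) x₀).toLinearMap => (b, z))
      (ContinuousLinearMap.inr ℝ W _) z := hasFDerivAt_prodMk_right b z
    have h3 := HasFDerivAt.comp z (g := fun v => f (c.symm v)) h1 h2
    refine h3.congr_fderiv ?_
    ext1 ζ
    refine hkeq _ hcs _ ?_
    rw [← hd (hcO hcs).2.1.1,
      ← dAt_congr (a := fun x => φ (f x)) (b := fun x => ContinuousLinearMap.fst ℝ W _ (c x))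
          (Filter.eventually_of_mem (c.open_source.mem_nhds hcs) hca),
      dAt_post (hc.smAt _ hcs)]
    exact congrArg Prod.fst (hc.dAt_vel hv hvel (0, ζ))
  have hconst := (convex_ball (c x₀).2 r).is_const_of_fderivWithin_eq_zero (𝕜 := ℝ)
    (fun z hz => (hder z hz).differentiableAt.differentiableWithinAt)
    (fun z hz => by
      rw [fderivWithin_of_isOpen Metric.isOpen_ball hz, (hder z hz).fderiv]) hcx.2 hcy.2
  have e2 : (b, (c y).2) = c y := Prod.ext e1 rfl
  rw [e2, c.left_inv hyc] at hconst
  rwa [show (b, (c x).2) = c x from rfl, c.left_inv hxc] at hconst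

end InverseFunction

/-! ### Submersions and local diffeomorphisms in terms of plots -/

section Submersions

variable {X : Type u} [TopologicalSpace X] [SmoothManifold X]
variable {Y : Type v} [TopologicalSpace Y] [SmoothManifold Y]
variable {Z : Type w} [TopologicalSpace Z] [SmoothManifold Z]
variable {V : Type*} [NormedAddCommGroup V] [NormedSpace ℝ V]
variable {W : Type*} [NormedAddCommGroup W] [NormedSpace ℝ W]

theorem Smooth.eventually_smAt {f : X → Y} (hf : Smooth f) {x : X}
    {c : OpenPartialHomeomorph Y W} (hc : IsCoord c) (hx : f x ∈ c.source) :
    ∀ᶠ z in 𝓝 x, SmAt (fun z => c (f z)) z := by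
  filter_upwards [hf.continuous.continuousAt.eventually (c.open_source.mem_nhds hx)] with z hz
  exact (hc.smAt _ hz).comp hf

/-- The normal form of a submersion: a coordinate projection. -/
theorem IsSubmersion.exists_coord {f : X → Y} (hf : IsSubmersion f) (x₀ : X) :
    ∃ (F : Submodule ℝ (Tan x₀)) (c : OpenPartialHomeomorph X (Tan (f x₀) × F)),
      IsCoord c ∧ x₀ ∈ c.source ∧
      ∀ x ∈ c.source, f x ∈ (chartNear (f x₀)).source ∧ (c x).1 = chartNear (f x₀) (f x) := by
  have hO : f ⁻¹' (chartNear (f x₀)).source ∈ 𝓝 x₀ := hf.1.continuous.continuousAt.preimage_mem_nhds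
    ((chartNear (f x₀)).open_source.mem_nhds (mem_chartNear_source _))
  obtain ⟨c, -, -, hc, hx, hcO, h1, -⟩ := exists_submersion_coord hO
    (hf.1.eventually_smAt (isCoord_chart (chartNear_mem (f x₀))) (mem_chartNear_source _)) (hf.2 x₀)
  exact ⟨_, c, hc, hx, fun x hx => ⟨hcO hx, h1 x hx⟩⟩

/-- Plots lift along submersions, through any point over the base point. -/
theorem IsSubmersion.exists_lift {f : X → Y} (hf : IsSubmersion f) {p : V → Y} {S : Set V}
    {v : V} (hp : PlotAt p S v) {x₀ : X} (hx : f x₀ = p v) :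
    ∃ q : V → X, PlotAt q S v ∧ q v = x₀ ∧ ∀ᶠ w in 𝓝[S] v, f (q w) = p w := by
  obtain ⟨F, c, hc, hxc, hcf⟩ := hf.exists_coord x₀
  set e := chartNear (f x₀)
  set g : V → Tan (f x₀) × F := fun w => (e (p w), (c x₀).2) with hg
  have hgv : g v = c x₀ := Prod.ext ((congrArg e hx).symm.trans (hcf x₀ hxc).2.symm) rfl
  have hpe : p v ∈ e.source := by
    rw [← hx]
    exact mem_chartNear_source _
  have hgs : ContDiffWithinAt ℝ ∞ g S v :=
    (hp.smooth e (chartNear_mem _) hpe).prodMk contDiffWithinAt_const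
  have hct := c.map_source hxc
  refine ⟨fun w => c.symm (g w), ?_, by simp only [hgv, c.left_inv hxc], ?_⟩
  · exact hc.plotAt_symm hgs hp.mem (by rwa [hgv])
  · filter_upwards [hp.cont.eventually (e.open_source.mem_nhds hpe),
      hgs.continuousWithinAt.eventually (p := fun u => u ∈ c.target)
        (by rw [hgv]; exact c.open_target.mem_nhds hct)] with w hw hw'
    obtain ⟨h1, h2⟩ := hcf _ (c.map_target hw')
    rw [c.right_inv hw'] at h2
    exact e.injOn h1 hw h2.symm

theorem isSubmersion_of_lift {f : X → Y} (hf : Smooth f)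
    (h : ∀ (n : ℕ) (p : Euc n → Y) (v : Euc n) (x : X), PlotAt p univ v → f x = p v →
      ∃ q : Euc n → X, PlotAt q univ v ∧ q v = x ∧ ∀ᶠ w in 𝓝 v, f (q w) = p w) :
    IsSubmersion f := by
  refine ⟨hf, fun x w => ?_⟩
  set e := chartNear (f x)
  have hx : f x ∈ e.source := mem_chartNear_source _
  obtain ⟨q, hq, hqx, hqf⟩ := h _ e.symm (e (f x)) x
    (plotAt_chart_symm (chartNear_mem _) (e.map_source hx)) (e.left_inv hx).symm
  have h1 := (hq.hasVel hqx).comp_smooth hf rfl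
  have h2 := h1.unique (hasVel_chartNear_symm (f x)) hqf
  exact ⟨_, DFunLike.congr_fun h2 w⟩

theorem IsSubmersion.comp {f : X → Y} {g : Y → Z} (hf : IsSubmersion f) (hg : IsSubmersion g) :
    IsSubmersion (fun x => g (f x)) := by
  refine isSubmersion_of_lift
    (smooth_of_plots fun n p v hp => hg.1.plotAt (hf.1.plotAt hp)) fun n p v x hp hx => ?_
  obtain ⟨q, hq, hqx, hqg⟩ := hg.exists_lift hp hx
  obtain ⟨r, hr, hrx, hrf⟩ := hf.exists_lift hq hqx.symm
  rw [nhdsWithin_univ] at hqg hrf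
  refine ⟨r, hr, hrx, ?_⟩
  filter_upwards [hqg, hrf] with w h1 h2
  rw [h2, h1]

/-- Smoothness may be checked after composition with a surjective submersion. -/
theorem Smooth.of_comp_submersion {π : X → Y} {f : Y → Z} (hπ : IsSubmersion π)
    (hs : Function.Surjective π) (hf : Smooth fun x => f (π x)) : Smooth f := by
  refine smooth_of_plots fun n p v hp => ?_
  obtain ⟨x, hx⟩ := hs (p v)
  obtain ⟨q, hq, -, hqp⟩ := hπ.exists_lift hp hx
  refine (hf.plotAt hq).congr ?_
  filter_upwards [hqp] with w hw
  simp [hw]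

theorem IsSubmersion.of_comp_submersion {π : X → Y} {f : Y → Z} (hπ : IsSubmersion π)
    (hs : Function.Surjective π) (hf : IsSubmersion fun x => f (π x)) : IsSubmersion f := by
  refine isSubmersion_of_lift (Smooth.of_comp_submersion hπ hs hf.1) fun n p v y hp hy => ?_
  obtain ⟨x, rfl⟩ := hs y
  obtain ⟨q, hq, hqx, hqf⟩ := hf.exists_lift hp hy
  rw [nhdsWithin_univ] at hqf
  exact ⟨fun w => π (q w), hπ.1.plotAt hq, congrArg π hqx, hqf⟩

/-- Every vector in the kernel of the derivative of a submersion is the velocity of a curve in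
the fiber. -/
theorem IsSubmersion.exists_curve {f : X → Y} (hf : IsSubmersion f) {x₀ : X} {y₀ : Y}
    (hy : f x₀ = y₀) {u : Tan x₀} (hu : tanMap f x₀ hy u = 0) :
    ∃ (p : ℝ → X) (A : ℝ →L[ℝ] Tan x₀), PlotAt p univ 0 ∧ HasVel p 0 x₀ A ∧ A 1 = u ∧
      ∀ᶠ τ in 𝓝 0, f (p τ) = y₀ := by
  subst hy
  obtain ⟨F, c, hc, hxc, hcf⟩ := hf.exists_coord x₀
  set e := chartNear (f x₀)
  set ζ := dAt c x₀ u
  have hζ : ζ.1 = 0 := by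
    rw [← hu]
    have h1 := dAt_post (hc.smAt x₀ hxc) (ContinuousLinearMap.fst ℝ (Tan (f x₀)) F) u
    rw [dAt_congr (a := fun x => e (f x))
      (b := fun x => ContinuousLinearMap.fst ℝ (Tan (f x₀)) F (c x))
      (Filter.eventually_of_mem (c.open_source.mem_nhds hxc) fun x hx => (hcf x hx).2)] at h1
    exact h1.symm
  set g : ℝ → Tan (f x₀) × F := fun τ => c x₀ + τ • ζ with hg
  have hg0 : g 0 = c x₀ := by simp [hg]
  have hgs : ContDiff ℝ ∞ g := contDiff_const.add (contDiff_id.smul contDiff_const)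
  have hct := c.map_source hxc
  have hp : PlotAt (fun τ => c.symm (g τ)) univ 0 :=
    hc.plotAt_symm hgs.contDiffAt.contDiffWithinAt (mem_univ _) (by rwa [hg0])
  have hvel := hp.hasVel (x := x₀) (by simp only [hg0, c.left_inv hxc])
  have hev : ∀ᶠ τ in 𝓝 0, g τ ∈ c.target := hgs.continuous.continuousAt.eventually
    (by rw [hg0]; exact c.open_target.mem_nhds hct)
  refine ⟨_, _, hp, hvel, ?_, ?_⟩
  · apply hc.dAt_injective hxc
    have h1 := hvel.comp_smAt (hc.smAt x₀ hxc)
    have h2 : HasFDerivAt g ((ContinuousLinearMap.id ℝ ℝ).smulRight ζ) 0 :=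
      ((ContinuousLinearMap.id ℝ ℝ).smulRight ζ).hasFDerivAt.const_add (c x₀)
    have h3 := (h2.congr_of_eventuallyEq
      (hev.mono fun τ hτ => c.right_inv hτ)).unique h1
    have h4 := DFunLike.congr_fun h3 1
    simp only [ContinuousLinearMap.smulRight_apply, ContinuousLinearMap.id_apply, one_smul] at h4
    exact h4.symm
  · filter_upwards [hev] with τ hτ
    obtain ⟨h1, h2⟩ := hcf _ (c.map_target hτ)
    rw [c.right_inv hτ] at h2
    refine e.injOn h1 (mem_chartNear_source _) ?_
    rw [← h2, ← (hcf x₀ hxc).2]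
    simp [hg, hζ]

/-- Maps that are the identity in suitable coordinates are local diffeomorphisms. -/
theorem isLocalDiffeo_of_coord {f : X → Y}
    (h : ∀ x, ∃ (n : ℕ) (c : OpenPartialHomeomorph X (Euc n)) (d : OpenPartialHomeomorph Y (Euc n)),
      IsCoord c ∧ IsCoord d ∧ x ∈ c.source ∧
        ∀ᶠ y in 𝓝 x, f y ∈ d.source ∧ d (f y) = c y) : IsLocalDiffeo f := by
  intro x
  obtain ⟨n, c, d, hc, hd, hx, hev⟩ := h x
  obtain ⟨U, hU, hUo, hxU⟩ := mem_nhds_iff.1 hev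
  set Φ := (c.restrOpen U hUo).trans d.symm
  have hs : ∀ y ∈ Φ.source, (y ∈ c.source ∧ y ∈ U) ∧ c y ∈ d.target := by
    intro y hy
    simpa [Φ] using hy
  refine ⟨Φ, ?_, fun y hy => ?_, smoothOn_of_plots fun n p v hp hv => ?_,
    smoothOn_of_plots fun n p v hp hv => ?_⟩
  · have h2 := hU hxU
    simp only [Φ, OpenPartialHomeomorph.trans_source, mem_inter_iff, mem_preimage,
      OpenPartialHomeomorph.restrOpen_source]
    refine ⟨⟨hx, hxU⟩, ?_⟩
    have := d.map_source h2.1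
    rw [h2.2] at this
    exact this
  · have h2 := hU (hs y hy).1.2
    change f y = d.symm (c y)
    rw [← h2.2, d.left_inv h2.1]
  · obtain ⟨h1, h2⟩ := hs _ hv
    exact hd.plotAt_symm ((hc.smAt _ h1.1).comp_plot hp) (mem_univ _) h2
  · have h1 : p v ∈ d.source ∧ d (p v) ∈ (c.restrOpen U hUo).target := by
      simpa [Φ, OpenPartialHomeomorph.trans_target] using hv
    exact hc.plotAt_symm ((hd.smAt _ h1.1).comp_plot hp) (mem_univ _) h1.2.1

theorem IsLocalDiffeo.comp_involution {f : X → Y} (hf : IsLocalDiffeo f) {i : X → X}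
    (hi : Smooth i) (hii : ∀ x, i (i x) = x) : IsLocalDiffeo (fun x => f (i x)) := by
  intro x
  obtain ⟨Φ, h1, h2, h3, h4⟩ := hf (i x)
  let I : X ≃ₜ X := ⟨⟨i, i, hii, hii⟩, hi.continuous, hi.continuous⟩
  refine ⟨I.toOpenPartialHomeomorph.trans Φ, ?_, fun y hy => ?_,
    smoothOn_of_plots fun n p v hp hv => ?_, smoothOn_of_plots fun n p v hp hv => ?_⟩
  · exact ⟨mem_univ _, h1⟩
  · exact h2 hy.2
  · exact SmoothOn.plotAt Φ.open_source h3 (hi.plotAt hp) hv.2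
  · exact hi.plotAt (SmoothOn.plotAt Φ.open_target h4 hp
      (by simpa [OpenPartialHomeomorph.trans_target] using hv))

/-- Plots lift uniquely along local diffeomorphisms; in particular these are submersions. -/
theorem IsLocalDiffeo.isSubmersion {f : X → Y} (hf : IsLocalDiffeo f) : IsSubmersion f := by
  have hsm : Smooth f := by
    refine smooth_of_plots fun n p v hp => ?_
    obtain ⟨Φ, h1, h2, h3, -⟩ := hf (p v)
    refine (SmoothOn.plotAt Φ.open_source h3 hp h1).congr ?_
    filter_upwards [hp.cont.eventually (Φ.open_source.mem_nhds h1)] with w hw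
    exact h2 hw
  refine isSubmersion_of_lift hsm fun n p v x hp hx => ?_
  obtain ⟨Φ, h1, h2, -, h4⟩ := hf x
  have hpv : p v ∈ Φ.target := by
    rw [← hx, h2 h1]
    exact Φ.map_source h1
  refine ⟨fun w => Φ.symm (p w), SmoothOn.plotAt Φ.open_target h4 hp hpv, ?_, ?_⟩
  · simp only [← hx, h2 h1, Φ.left_inv h1]
  · filter_upwards [hp.continuousAt.eventually (Φ.open_target.mem_nhds hpv)] with w hw
    rw [h2 (Φ.map_target hw), Φ.right_inv hw]

end Submersions

/-! ### Embedded submanifolds -/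

section Submanifolds

variable {X : Type u} [TopologicalSpace X] [SmoothManifold X]
variable {Y : Type v} [TopologicalSpace Y] [SmoothManifold Y]
variable {V : Type*} [NormedAddCommGroup V] [NormedSpace ℝ V]
variable {W : Type*} [NormedAddCommGroup W] [NormedSpace ℝ W]

/-- A local coordinate system on the subset `P ∩ U` of the manifold `X`, where `U` is open, with
image the open set `O` and inverse `b`. It is the restriction of the function `a`, which is smooth
as a function on `X`; this makes `P ∩ U` an embedded submanifold. -/
structure IsSubChart (P U : Set X) (O : Set W) (a : X → W) (b : W → X) : Prop where
  isOpen_source : IsOpen U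
  isOpen_target : IsOpen O
  smAt : ∀ x ∈ P ∩ U, SmAt a x
  plotAt : ∀ w ∈ O, PlotAt b univ w
  maps : ∀ x ∈ P ∩ U, a x ∈ O ∧ b (a x) = x
  inv : ∀ w ∈ O, b w ∈ P ∩ U ∧ a (b w) = w

/-- The subset `P` is locally parametrized by open sets in Euclidean spaces. -/
def IsSubmfd (P : Set X) : Prop :=
  ∀ x ∈ P, ∃ (n : ℕ) (U : Set X) (O : Set (Euc n)) (a : X → Euc n) (b : Euc n → X),
    IsSubChart P U O a b ∧ x ∈ U

theorem IsSubChart.equiv {P U : Set X} {O : Set W} {a : X → W} {b : W → X}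
    (h : IsSubChart P U O a b) (L : W ≃L[ℝ] V) :
    IsSubChart P U (L.symm ⁻¹' O) (fun x => L (a x)) (fun v => b (L.symm v)) where
  isOpen_source := h.isOpen_source
  isOpen_target := h.isOpen_target.preimage L.symm.continuous
  smAt x hx := (h.smAt x hx).post L.contDiff.contDiffAt
  plotAt w hw := (h.plotAt _ hw).comp L.symm.contDiff.contDiffAt.contDiffWithinAt (mem_univ _)
    (mapsTo_univ _ _)
  maps x hx := by simpa using h.maps x hx
  inv w hw := by
    have := h.inv _ hw
    exact ⟨this.1, by rw [this.2, L.apply_symm_apply]⟩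

theorem IsSubmfd.of_subChart {P : Set X}
    (h : ∀ x ∈ P, ∃ (W : Type) (_ : NormedAddCommGroup W) (_ : NormedSpace ℝ W)
      (_ : FiniteDimensional ℝ W) (U : Set X) (O : Set W) (a : X → W) (b : W → X),
      IsSubChart P U O a b ∧ x ∈ U) : IsSubmfd P := by
  intro x hx
  obtain ⟨W, _, _, _, U, O, a, b, h, hxU⟩ := h x hx
  have L : W ≃L[ℝ] Euc (Module.finrank ℝ W) :=
    ContinuousLinearEquiv.ofFinrankEq (by simp)
  exact ⟨_, _, _, _, _, h.equiv L, hxU⟩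

open Classical in
/-- The local homeomorphism of the subspace `P` given by a coordinate system. -/
noncomputable def IsSubChart.toHomeo {P U : Set X} {O : Set W} {a : X → W} {b : W → X}
    (h : IsSubChart P U O a b) (x₀ : P) : OpenPartialHomeomorph P W where
  toFun x := a x
  invFun w := if hw : b w ∈ P then ⟨b w, hw⟩ else x₀
  source := Subtype.val ⁻¹' U
  target := O
  map_source' x hx := (h.maps x ⟨x.2, hx⟩).1
  map_target' w hw := by
    have := (h.inv w hw).1
    simp [this.1, this.2]
  left_inv' x hx := by
    have := (h.maps x ⟨x.2, hx⟩).2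
    simp [this]
  right_inv' w hw := by
    have := h.inv w hw
    simp [this.1.1, this.2]
  open_source := h.isOpen_source.preimage continuous_subtype_val
  open_target := h.isOpen_target
  continuousOn_toFun x hx := ((h.smAt x ⟨x.2, hx⟩).continuousAt.comp
    continuous_subtype_val.continuousAt).continuousWithinAt
  continuousOn_invFun := by
    refine IsInducing.subtypeVal.continuousOn_iff.2 fun w hw => ?_
    refine (h.plotAt w hw).continuousAt.continuousWithinAt.congr (fun w hw => ?_) ?_
    · simp [(h.inv w hw).1.1]
    · simp [(h.inv w hw).1.1]

theorem IsSubChart.val_toHomeo_symm {P U : Set X} {O : Set W} {a : X → W} {b : W → X}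
    (h : IsSubChart P U O a b) (x₀ : P) {w : W} (hw : w ∈ O) :
    ((h.toHomeo x₀).symm w : X) = b w := by
  have : (h.toHomeo x₀).symm w = ⟨b w, (h.inv w hw).1.1⟩ := dif_pos (h.inv w hw).1.1
  rw [this]

/-- The smooth structure on a submanifold. -/
@[reducible] def IsSubmfd.smoothManifold {P : Set X} (h : IsSubmfd P) : SmoothManifold P where
  charts n := {c | ∃ (U : Set X) (O : Set (Euc n)) (a : X → Euc n) (b : Euc n → X)
    (h : IsSubChart P U O a b) (x₀ : P), c = h.toHomeo x₀}
  exists_chart x := by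
    obtain ⟨n, U, O, a, b, h, hx⟩ := h x x.2
    exact ⟨n, h.toHomeo x, ⟨U, O, a, b, h, x, rfl⟩, hx⟩
  compatible := by
    rintro n k c ⟨U, O, a, b, h, x₀, rfl⟩ d ⟨U', O', a', b', h', x₀', rfl⟩ w ⟨hw, hw'⟩
    have e : ∀ w ∈ O, (h'.toHomeo x₀' ∘ (h.toHomeo x₀).symm) w = a' (b w) := fun w hw =>
      congrArg a' (h.val_toHomeo_symm x₀ hw)
    have hbw : b w ∈ P ∩ U' :=
      ⟨(h.inv w hw).1.1, by rw [← h.val_toHomeo_symm x₀ hw]; exact hw'⟩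
    refine ContDiffAt.contDiffWithinAt ?_
    refine ((h'.smAt _ hbw).comp_plot_univ (h.plotAt w hw) rfl).congr_of_eventuallyEq ?_
    filter_upwards [h.isOpen_target.mem_nhds hw] with w hw
    exact e w hw

/-- The smooth structure of the subspace `P` is induced by that of `X`: the inclusion is
smooth and the plots of `P` are the plots of `X` with values in `P`. -/
structure IsInduced (P : Set X) [SmoothManifold P] : Prop where
  smooth_val : Smooth (Subtype.val : P → X)
  plotAt : ∀ {V : Type} [NormedAddCommGroup V] [NormedSpace ℝ V] {p : V → P} {S : Set V} {v : V},
    PlotAt (fun w => (p w : X)) S v → PlotAt p S v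

theorem IsSubChart.isCoord {P U : Set X} (hP : IsSubmfd P) {n : ℕ} {O : Set (Euc n)}
    {a : X → Euc n} {b : Euc n → X} (h : IsSubChart P U O a b) (x₀ : P) :
    letI := hP.smoothManifold
    IsCoord (h.toHomeo x₀) :=
  letI := hP.smoothManifold
  isCoord_chart (c := h.toHomeo x₀) ⟨U, O, a, b, h, x₀, rfl⟩

theorem IsSubmfd.isInduced {P : Set X} (hP : IsSubmfd P) :
    letI := hP.smoothManifold
    IsInduced P := by
  let := hP.smoothManifold
  refine ⟨smooth_of_plots fun m p v hp => ?_, fun {V} _ _ p S v hp => ?_⟩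
  · obtain ⟨n, U, O, a, b, h, hx⟩ := hP (p v) (p v).2
    have hc := h.isCoord hP (p v)
    have h1 := (hc.smAt (p v) hx).comp_plot hp
    have hO : a (p v) ∈ O := (h.maps (p v) ⟨(p v).2, hx⟩).1
    have h2 : PlotAt (fun w => b (a (p w))) univ v :=
      (h.plotAt (a (p v)) hO).comp (g := fun w => a (p w)) h1 (mem_univ _) (mapsTo_univ _ _)
    refine h2.congr ?_
    filter_upwards [hp.cont.eventually ((h.toHomeo (p v)).open_source.mem_nhds hx)] with w hw
    exact ((h.maps _ ⟨(p w).2, hw⟩).2).symm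
  · obtain ⟨n, U, O, a, b, h, hx⟩ := hP (p v) (p v).2
    have hc := h.isCoord hP (p v)
    exact PlotAt.of_coord hc hp.mem
      (IsInducing.subtypeVal.continuousWithinAt_iff.2 hp.cont) hx
      (SmAt.comp_plot (p := fun w => (p w : X)) (h.smAt (p v) ⟨(p v).2, hx⟩) hp)

theorem IsSubmfd.isSmoothEmbedding {P : Set X} (hP : IsSubmfd P) :
    letI := hP.smoothManifold
    IsSmoothEmbedding (Subtype.val : P → X) := by
  let := hP.smoothManifold
  have hi := hP.isInduced
  refine ⟨hi.smooth_val, fun x => ?_, IsEmbedding.subtypeVal⟩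
  obtain ⟨n, U, O, a, b, h, hx⟩ := hP x x.2
  have hc := h.isCoord hP x
  rw [injective_iff_map_eq_zero]
  intro u hu
  apply (injective_iff_map_eq_zero _).1 (hc.dAt_injective (x := x) hx)
  have h1 := dAt_comp hi.smooth_val (x := x) rfl (h.smAt x ⟨x.2, hx⟩) u
  rw [hu, map_zero] at h1
  exact h1

open Classical in
/-- Corestriction of plots to a subspace with the induced smooth structure. -/
theorem IsInduced.exists_plot {P : Set X} [SmoothManifold P] (hP : IsInduced P)
    {V : Type} [NormedAddCommGroup V] [NormedSpace ℝ V] {q : V → X} {S : Set V} {v : V}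
    (hq : PlotAt q S v) (h : ∀ᶠ w in 𝓝[S] v, q w ∈ P) :
    ∃ p : V → P, PlotAt p S v ∧ ∀ w, q w ∈ P → (p w : X) = q w := by
  have hv : q v ∈ P := h.self_of_nhdsWithin hq.mem
  refine ⟨fun w => if hw : q w ∈ P then ⟨q w, hw⟩ else ⟨q v, hv⟩, hP.plotAt (hq.congr ?_), ?_⟩
  · filter_upwards [h] with w hw
    simp [hw]
  · intro w hw
    simp [hw]

/-- Preimages of submanifolds under submersions are submanifolds. -/
theorem IsSubmfd.preimage {π : X → Y} (hπ : IsSubmersion π) {Q : Set Y} (hQ : IsSubmfd Q) :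
    IsSubmfd (π ⁻¹' Q) := by
  refine IsSubmfd.of_subChart fun x₀ hx₀ => ?_
  obtain ⟨F, c, hc, hxc, hcπ⟩ := hπ.exists_coord x₀
  obtain ⟨n, U, O, a, b, h, hU⟩ := hQ (π x₀) hx₀
  set e := chartNear (π x₀)
  set O₁ := O ∩ b ⁻¹' e.source
  have hO₁ : IsOpen O₁ := ContinuousOn.isOpen_inter_preimage
    (fun w hw => (h.plotAt w hw).continuousAt.continuousWithinAt) h.isOpen_target e.open_source
  have hcont : ContinuousOn (fun wz : Euc n × F => (e (b wz.1), wz.2)) (O₁ ×ˢ univ) := by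
    rintro ⟨w, z⟩ ⟨⟨hw, hw'⟩, -⟩
    refine ContinuousAt.continuousWithinAt (ContinuousAt.prodMk ?_ continuousAt_snd)
    exact ContinuousAt.comp (g := e) (e.continuousAt hw')
      (ContinuousAt.comp (g := b) (h.plotAt w hw).continuousAt continuousAt_fst)
  refine ⟨Euc n × F, inferInstance, inferInstance, inferInstance, c.source ∩ π ⁻¹' U,
    (O₁ ×ˢ univ) ∩ (fun wz : Euc n × F => (e (b wz.1), wz.2)) ⁻¹' c.target,
    fun x => (a (π x), (c x).2), fun wz => c.symm (e (b wz.1), wz.2), ⟨?_, ?_, ?_, ?_, ?_, ?_⟩,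
    hxc, hU⟩
  · exact c.open_source.inter (h.isOpen_source.preimage hπ.1.continuous)
  · exact hcont.isOpen_inter_preimage (hO₁.prod isOpen_univ) c.open_target
  · rintro x ⟨hx, hxc, hxU⟩
    exact ((h.smAt (π x) ⟨hx, hxU⟩).comp hπ.1).prodMk
      ((hc.smAt x hxc).post (g := Prod.snd) contDiffAt_snd)
  · rintro ⟨w, z⟩ ⟨⟨⟨hw, hw'⟩, -⟩, hwz⟩
    refine hc.plotAt_symm ?_ (mem_univ _) hwz
    refine ContDiffWithinAt.prodMk ?_ contDiffWithinAt_snd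
    have h1 : PlotAt (fun wz : Euc n × F => b wz.1) univ (w, z) :=
      (h.plotAt w hw).comp contDiffWithinAt_fst (mem_univ _) (mapsTo_univ _ _)
    exact SmAt.comp_plot (p := fun wz : Euc n × F => b wz.1)
      (smAt_chart (chartNear_mem (π x₀)) hw') h1
  · rintro x ⟨hx, hxc, hxU⟩
    obtain ⟨h1, h2⟩ := h.maps (π x) ⟨hx, hxU⟩
    obtain ⟨h3, h4⟩ := hcπ x hxc
    have h5 : (e (b (a (π x))), (c x).2) = c x := by
      rw [h2, ← h4]
    refine ⟨⟨⟨⟨h1, ?_⟩, mem_univ _⟩, ?_⟩, ?_⟩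
    · rw [mem_preimage, h2]
      exact h3
    · rw [mem_preimage, h5]
      exact c.map_source hxc
    · simp only
      rw [h5, c.left_inv hxc]
  · rintro ⟨w, z⟩ ⟨⟨⟨hw, hw'⟩, -⟩, hwz⟩
    have hwz' : (e (b w), z) ∈ c.target := hwz
    obtain ⟨h1, h2⟩ := hcπ _ (c.map_target hwz')
    rw [c.right_inv hwz'] at h2
    have h3 : b w = π (c.symm (e (b w), z)) := e.injOn hw' h1 h2
    obtain ⟨h4, h5⟩ := h.inv w hw
    simp only
    refine ⟨⟨?_, c.map_target hwz', ?_⟩, ?_⟩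
    · rw [mem_preimage, ← h3]
      exact h4.1
    · rw [mem_preimage, ← h3]
      exact h4.2
    · rw [← h3, h5, c.right_inv hwz']

/-- The image of a smooth section is a submanifold. -/
theorem isSubmfd_range_section {σ : X → Y} {r : Y → X} (hσ : Smooth σ) (hr : Smooth r)
    (h : ∀ x, r (σ x) = x) : IsSubmfd (range σ) := by
  rintro _ ⟨x₀, rfl⟩
  set c := chartNear x₀
  have hc : IsCoord c := isCoord_chart (chartNear_mem x₀)
  refine ⟨_, r ⁻¹' c.source, c.target, fun y => c (r y), fun w => σ (c.symm w),
    ⟨?_, c.open_target, ?_, ?_, ?_, ?_⟩, ?_⟩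
  · exact c.open_source.preimage hr.continuous
  · rintro y ⟨-, hy⟩
    exact (hc.smAt _ hy).comp hr
  · exact fun w hw => hσ.plotAt (hc.plotAt w hw)
  · rintro _ ⟨⟨x, rfl⟩, hx⟩
    simp only [mem_preimage, h] at hx
    simp only [h, c.left_inv hx, and_true]
    exact c.map_source hx
  · intro w hw
    simp only [h, c.right_inv hw, and_true]
    exact ⟨⟨_, rfl⟩, by rw [mem_preimage, h]; exact c.map_target hw⟩
  · rw [mem_preimage, h]
    exact mem_chartNear_source x₀

/-- Slice coordinates: given an embedding `i` and a complement `F` of its tangent space at `x₀`,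
there are coordinates of the ambient manifold with values in a product with `F`, in which the
image of `i` is given by the vanishing of the second component, and in which
the subspace `F` of the tangent space at `x₀` is the second factor. -/
theorem IsSmoothEmbedding.exists_slice {i : X → Y} (hi : IsSmoothEmbedding i) (x₀ : X)
    {F : Submodule ℝ (Tan (i x₀))}
    (hF : IsCompl F (LinearMap.range (tanMap i x₀ rfl).toLinearMap)) :
    ∃ Φ : OpenPartialHomeomorph Y (Tan x₀ × F), IsCoord Φ ∧ i x₀ ∈ Φ.source ∧
      (∀ y ∈ Φ.source, (Φ y).2 = 0 → y ∈ range i) ∧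
      (∀ x, i x ∈ Φ.source → x ∈ (chartNear x₀).source ∧ Φ (i x) = (chartNear x₀ x, 0)) ∧
      ∀ u : F, dAt Φ (i x₀) u = (0, u) := by
  set c := chartNear x₀
  set e := chartNear (i x₀)
  have hx₀ : x₀ ∈ c.source := mem_chartNear_source x₀
  have hex₀ : i x₀ ∈ e.source := mem_chartNear_source _
  have hct : c x₀ ∈ c.target := c.map_source hx₀
  set H : Tan x₀ × F → Tan (i x₀) := fun wz => e (i (c.symm wz.1)) + wz.2 with hH
  have hH₀ : H (c x₀, 0) = e (i x₀) := by simp [hH, c.left_inv hx₀]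
  -- the derivative of `H` at the base point is the sum of the two complementary subspaces
  have hd : HasFDerivAt H ((tanMap i x₀ rfl).coprod F.subtypeL) (c x₀, 0) := by
    have h1 : HasFDerivAt (fun w => e (i (c.symm w))) (tanMap i x₀ rfl) (c x₀) :=
      (smAt_chart_comp hi.1 rfl).hasFDerivAt
    have h2 := (HasFDerivAt.comp (c x₀, (0 : F)) (g := fun w => e (i (c.symm w))) h1
      hasFDerivAt_fst).add (F.subtypeL.hasFDerivAt.comp (c x₀, (0 : F)) hasFDerivAt_snd)
    refine h2.congr_fderiv ?_
    ext u <;> simp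
  have hsm : ∀ w ∈ c.target, i (c.symm w) ∈ e.source → ∀ z, ContDiffAt ℝ ∞ H (w, z) := by
    intro w hw hw' z
    have h1 : PlotAt (fun wz : Tan x₀ × F => i (c.symm wz.1)) univ (w, z) :=
      hi.1.plotAt ((plotAt_chart_symm (chartNear_mem x₀) hw).comp contDiffWithinAt_fst
        (mem_univ _) (mapsTo_univ _ _))
    exact ((smAt_chart (chartNear_mem (i x₀)) hw').comp_plot_univ h1 rfl).add
      (F.subtypeL.contDiff.contDiffAt.comp (w, z) contDiffAt_snd)
  have hN : IsOpen (c.target ∩ (fun w => i (c.symm w)) ⁻¹' e.source) :=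
    ContinuousOn.isOpen_inter_preimage (hi.1.continuous.comp_continuousOn c.continuousOn_symm)
      c.open_target e.open_source
  set N := c.target ∩ (fun w => i (c.symm w)) ⁻¹' e.source
  have hxN : c x₀ ∈ N := ⟨hct, by simpa [c.left_inv hx₀] using hex₀⟩
  have hNn : N ×ˢ univ ∈ 𝓝 (c x₀, (0 : F)) := (hN.prod isOpen_univ).mem_nhds ⟨hxN, mem_univ _⟩
  obtain ⟨Ψ, hΨ1, hΨ2, hΨ3, hΨ4, hΨ5⟩ := exists_localDiffeo (h := H) hNn
    (Filter.eventually_of_mem hNn fun wz hwz => hsm wz.1 hwz.1.1 hwz.1.2 wz.2) (by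
      rw [hd.fderiv]
      have hinj := hi.2.1 x₀
      constructor
      · rw [injective_iff_map_eq_zero]
        rintro ⟨u, z⟩ huz
        rw [ContinuousLinearMap.coprod_apply] at huz
        have h1 : (z : Tan (i x₀)) = - tanMap i x₀ rfl u := by
          rw [eq_neg_iff_add_eq_zero, add_comm]
          exact huz
        have h2 : (z : Tan (i x₀)) ∈ LinearMap.range (tanMap i x₀ rfl).toLinearMap :=
          ⟨-u, by rw [h1]; simp⟩
        have h3 := (Submodule.disjoint_def.1 hF.disjoint) z z.2 h2
        rw [h3, eq_comm, neg_eq_zero] at h1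
        rw [(injective_iff_map_eq_zero _).1 hinj u h1, Prod.mk_eq_zero]
        exact ⟨rfl, Subtype.ext h3⟩
      · intro y
        obtain ⟨f, hf, t, ⟨u, rfl⟩, rfl⟩ := Submodule.mem_sup.1
          (hF.sup_eq_top ▸ Submodule.mem_top : y ∈ F ⊔ _)
        exact ⟨(u, ⟨f, hf⟩), by rw [ContinuousLinearMap.coprod_apply]; exact add_comm _ _⟩)
  -- shrink the domain, so that it meets the image of `i` only in the given chart of `X`
  have hA : IsOpen (c.source ∩ (fun x => (c x, (0 : F))) ⁻¹' Ψ.source) :=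
    ContinuousOn.isOpen_inter_preimage (c.continuousOn.prodMk continuousOn_const) c.open_source
      Ψ.open_source
  obtain ⟨B, hB, hBA⟩ := hi.2.2.isInducing.isOpen_iff.1 hA
  have hΨe : ∀ y, y ∈ e.source → e y ∈ Ψ.target → (e.trans Ψ.symm) y = Ψ.symm (e y) :=
    fun _ _ _ => rfl
  set Φ := (e.trans Ψ.symm).restrOpen B hB
  have hΦ : IsCoord Φ := ((isCoord_chart (chartNear_mem (i x₀))).trans hΨ5 (by
    simpa using hΨ4)).restr hB
  have hΦs : ∀ y, y ∈ Φ.source ↔ (y ∈ e.source ∧ e y ∈ Ψ.target) ∧ y ∈ B := by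
    intro y
    simp [Φ]
  have hslice : ∀ x, i x ∈ Φ.source → x ∈ c.source ∧ Φ (i x) = (c x, 0) := by
    intro x hx
    have hxB : x ∈ i ⁻¹' B := ((hΦs _).1 hx).2
    rw [hBA] at hxB
    refine ⟨hxB.1, ?_⟩
    change Ψ.symm (e (i x)) = _
    have : Ψ (c x, 0) = e (i x) := by rw [hΨ3]; simp [hH, c.left_inv hxB.1]
    rw [← this, Ψ.left_inv hxB.2]
  have hx₀Φ : i x₀ ∈ Φ.source := by
    refine (hΦs _).2 ⟨⟨hex₀, ?_⟩, ?_⟩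
    · rw [← hH₀, ← hΨ3]
      exact Ψ.map_source hΨ1
    · change x₀ ∈ i ⁻¹' B
      rw [hBA]
      exact ⟨hx₀, hΨ1⟩
  refine ⟨Φ, hΦ, hx₀Φ, fun y hy h0 => ?_, hslice, fun u => ?_⟩
  · obtain ⟨⟨h1, h2⟩, -⟩ := (hΦs y).1 hy
    have h3 : Φ y = Ψ.symm (e y) := rfl
    have h4 : Φ y ∈ Ψ.source := by
      rw [h3]
      exact Ψ.map_target h2
    have h5 : H (Φ y) = e y := by
      rw [h3, ← hΨ3, Ψ.right_inv h2]
    have h6 : H (Φ y) = e (i (c.symm (Φ y).1)) := by simp [hH, h0]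
    exact ⟨c.symm (Φ y).1, e.injOn (hΨ2 h4).1.2 h1 (h6.symm.trans h5)⟩
  · have hΦx : Φ (i x₀) = (c x₀, 0) := (hslice x₀ hx₀Φ).2
    have ht : (c x₀, (0 : F)) ∈ Φ.target := hΦx ▸ Φ.map_source hx₀Φ
    have hs : Φ.symm (c x₀, 0) = i x₀ := by rw [← hΦx, Φ.left_inv hx₀Φ]
    have hvel : HasVel Φ.symm (c x₀, (0 : F)) (i x₀)
        ((tanMap i x₀ rfl).coprod F.subtypeL) := by
      refine ⟨hs, (hΦ.plotAt _ ht).continuousAt, hd.congr_of_eventuallyEq ?_⟩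
      filter_upwards [Φ.open_target.mem_nhds ht] with w hw
      have h1 := Φ.right_inv hw
      obtain ⟨⟨h2, h3⟩, -⟩ := (hΦs _).1 (Φ.map_target hw)
      have h4 : Ψ.symm (e (Φ.symm w)) = w := h1
      rw [← hΨ3, ← h4, Ψ.right_inv h3, h4]
    have := hΦ.dAt_vel ht hvel (0, u)
    simpa using this

theorem IsSmoothEmbedding.isInduced {P : Set X} [SmoothManifold P]
    (hP : IsSmoothEmbedding (Subtype.val : P → X)) : IsInduced P := by
  refine ⟨hP.1, fun {V} _ _ p S v hp => ?_⟩
  obtain ⟨F, hF⟩ := Submodule.exists_isCompl (LinearMap.range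
    (tanMap (Subtype.val : P → X) (p v) rfl).toLinearMap)
  obtain ⟨Φ, hΦ, hx, -, hs, -⟩ := hP.exists_slice (p v) hF.symm
  refine PlotAt.of_chart (chartNear_mem (p v)) hp.mem
    (IsInducing.subtypeVal.continuousWithinAt_iff.2 hp.cont) (mem_chartNear_source _) ?_
  have h1 : ContDiffWithinAt ℝ ∞ (fun w => (Φ (p w)).1) S v :=
    (SmAt.comp_plot (p := fun w => (p w : X)) (hΦ.smAt _ hx) hp).fst
  refine h1.congr_of_eventuallyEq ?_ ?_
  · filter_upwards [hp.cont.eventually (Φ.open_source.mem_nhds hx)] with w hw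
    rw [(hs (p w) hw).2]
  · rw [(hs (p v) hx).2]

end Submanifolds

/-! ### Lie groupoids -/

theorem finrank_ker_inf_ker {U V₁ V₂ : Type*} [AddCommGroup U] [Module ℝ U]
    [FiniteDimensional ℝ U] [AddCommGroup V₁] [Module ℝ V₁] [AddCommGroup V₂] [Module ℝ V₂]
    (A : U →ₗ[ℝ] V₁) (B : U →ₗ[ℝ] V₂) (hA : Function.Surjective A) :
    Module.finrank ℝ ↥(LinearMap.ker A ⊓ LinearMap.ker B) +
      Module.finrank ℝ ((LinearMap.ker A).map B) + Module.finrank ℝ V₁ = Module.finrank ℝ U := by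
  have h1 := LinearMap.finrank_range_add_finrank_ker (B.domRestrict (LinearMap.ker A))
  have h2 := LinearMap.finrank_range_add_finrank_ker A
  rw [LinearMap.range_eq_top.2 hA, finrank_top] at h2
  rw [LinearMap.range_domRestrict, LinearMap.ker_domRestrict,
    ← Submodule.finrank_map_subtype_eq, Submodule.map_comap_subtype] at h1
  omega

namespace GroupoidStr

section Plots

variable {M : Type u} {G : Type v} [TopologicalSpace G] [SmoothManifold G] {Γ : GroupoidStr M G}

theorem smoothMul_of_plots
    (h : ∀ {V : Type} [NormedAddCommGroup V] [NormedSpace ℝ V] {a b : V → G} {S : Set V} {v : V},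
      PlotAt a S v → PlotAt b S v → (∀ w ∈ S, Γ.s (a w) = Γ.t (b w)) →
      PlotAt (fun w => Γ.mul (a w) (b w)) S v) : Γ.SmoothMul := by
  have key : ∀ (n k : ℕ), ∀ c ∈ SmoothManifold.charts (X := G) n,
      ∀ d ∈ SmoothManifold.charts (X := G) k, ∀ p : Euc n × Euc k,
      p ∈ {p : Euc n × Euc k | p.1 ∈ c.target ∧ p.2 ∈ d.target ∧
        Γ.s (c.symm p.1) = Γ.t (d.symm p.2)} →
      PlotAt (fun p : Euc n × Euc k => Γ.mul (c.symm p.1) (d.symm p.2))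
        {p : Euc n × Euc k | p.1 ∈ c.target ∧ p.2 ∈ d.target ∧
          Γ.s (c.symm p.1) = Γ.t (d.symm p.2)} p := by
    intro n k c hc d hd p hp
    exact h ((plotAt_chart_symm hc hp.1).comp (g := Prod.fst) contDiffWithinAt_fst hp
        (mapsTo_univ _ _))
      ((plotAt_chart_symm hd hp.2.1).comp (g := Prod.snd) contDiffWithinAt_snd hp
        (mapsTo_univ _ _)) fun w hw => hw.2.2
  refine ⟨?_, fun n k l c hc d hd e he p hp => ?_⟩
  · rintro ⟨g, g'⟩ hg
    set c := chartNear g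
    set d := chartNear g'
    have hc : g ∈ c.source := mem_chartNear_source g
    have hd : g' ∈ d.source := mem_chartNear_source g'
    have hg' : Γ.s g = Γ.t g' := hg
    have h1 := (key _ _ c (chartNear_mem _) d (chartNear_mem _) (c g, d g')
      ⟨c.map_source hc, d.map_source hd, by simp only [c.left_inv hc, d.left_inv hd, hg']⟩).cont
    set N : Set (G × G) := c.source ×ˢ d.source
    have hN : N ∈ 𝓝 (g, g') := (c.open_source.prod d.open_source).mem_nhds ⟨hc, hd⟩
    rw [← continuousWithinAt_inter hN]
    have h2 : ContinuousWithinAt (fun p : G × G => (c p.1, d p.2))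
        ({p : G × G | Γ.s p.1 = Γ.t p.2} ∩ N) (g, g') :=
      (ContinuousAt.prodMk (ContinuousAt.comp (f := Prod.fst) (c.continuousAt hc) continuousAt_fst)
        (ContinuousAt.comp (f := Prod.snd) (d.continuousAt hd)
          continuousAt_snd)).continuousWithinAt
    refine (ContinuousWithinAt.comp (f := fun p : G × G => (c p.1, d p.2)) h1 h2 ?_).congr_of_mem
      ?_ ⟨hg, hc, hd⟩
    · rintro ⟨a, b⟩ ⟨hab, ha, hb⟩
      exact ⟨c.map_source ha, d.map_source hb, by simpa only [c.left_inv ha, d.left_inv hb]⟩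
    · rintro ⟨a, b⟩ ⟨hab, ha, hb⟩
      simp [c.left_inv ha, d.left_inv hb]
  · exact ((key n k c hc d hd p ⟨hp.1, hp.2.1, hp.2.2.1⟩).smooth e he hp.2.2.2).mono
      fun q hq => ⟨hq.1, hq.2.1, hq.2.2.1⟩

variable {V : Type*} [NormedAddCommGroup V] [NormedSpace ℝ V]

theorem SmoothMul.plotAt (hΓ : Γ.SmoothMul) {a b : V → G} {S : Set V} {v : V}
    (ha : PlotAt a S v) (hb : PlotAt b S v) (hab : ∀ᶠ w in 𝓝[S] v, Γ.s (a w) = Γ.t (b w)) :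
    PlotAt (fun w => Γ.mul (a w) (b w)) S v := by
  set c := chartNear (a v)
  set d := chartNear (b v)
  set e := chartNear (Γ.mul (a v) (b v))
  have hc := mem_chartNear_source (a v)
  have hd := mem_chartNear_source (b v)
  have he := mem_chartNear_source (Γ.mul (a v) (b v))
  have hv := hab.self_of_nhdsWithin ha.mem
  set N : Set V := {w | Γ.s (a w) = Γ.t (b w) ∧ a w ∈ c.source ∧ b w ∈ d.source}
  have hN : N ∈ 𝓝[S] v := hab.and ((ha.cont.eventually (c.open_source.mem_nhds hc)).and
    (hb.cont.eventually (d.open_source.mem_nhds hd)))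
  refine PlotAt.of_inter (N := N) ?_ hN
  have hvS : v ∈ S ∩ N := ⟨ha.mem, hv, hc, hd⟩
  have ha' := ha.mono (inter_subset_left (t := N)) hvS
  have hb' := hb.mono (inter_subset_left (t := N)) hvS
  have hcont : ContinuousWithinAt (fun w => Γ.mul (a w) (b w)) (S ∩ N) v :=
    (hΓ.1 (a v, b v) hv).comp (f := fun w => (a w, b w)) (ha'.cont.prodMk hb'.cont)
      fun w hw => hw.2.1
  refine PlotAt.of_inter (N := {w | Γ.mul (a w) (b w) ∈ e.source}) ?_
    (hcont.eventually (e.open_source.mem_nhds he))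
  have hvS' : v ∈ S ∩ N ∩ {w | Γ.mul (a w) (b w) ∈ e.source} := ⟨hvS, he⟩
  have ha'' := ha'.mono inter_subset_left hvS'
  have hb'' := hb'.mono inter_subset_left hvS'
  refine PlotAt.of_chart (chartNear_mem _) hvS' (hcont.mono inter_subset_left) he ?_
  have h1 := hΓ.2 _ _ _ c (chartNear_mem _) d (chartNear_mem _) e (chartNear_mem _)
  have h2 := (h1 (c (a v), d (b v)) (by
    simp only [mem_ofPred_eq, c.left_inv hc, d.left_inv hd]
    exact ⟨c.map_source hc, d.map_source hd, hv, he⟩)).comp v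
    (f := fun w => (c (a w), d (b w)))
    (s := S ∩ N ∩ {w | Γ.mul (a w) (b w) ∈ e.source})
    ((ha''.smooth c (chartNear_mem _) hc).prodMk (hb''.smooth d (chartNear_mem _) hd)) (by
      rintro w ⟨⟨-, h1, h2, h3⟩, h4⟩
      simp only [mem_ofPred_eq, c.left_inv h2, d.left_inv h3]
      exact ⟨c.map_source h2, d.map_source h3, h1, h4⟩)
  refine h2.congr_of_mem (fun w hw => ?_) hvS'
  change e _ = e (Γ.mul (c.symm (c (a w))) (d.symm (d (b w))))
  rw [c.left_inv hw.1.2.2.1, d.left_inv hw.1.2.2.2]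

end Plots

section LieGroupoids

variable {M : Type u} [TopologicalSpace M] [SmoothManifold M]
variable {G : Type v} [TopologicalSpace G] [SmoothManifold G] {Γ : GroupoidStr M G}

/-- Right translation maps a vector tangent to a source fiber to such a vector, with the same
image under the tangent map of the target. -/
theorem IsLie.exists_translate (hΓ : Γ.IsLie) {g h k : G} (hgh : Γ.s g = Γ.t h)
    (hk : Γ.mul g h = k) {x y z : M} (hx : Γ.t g = x) (hx' : Γ.t k = x) (hy : Γ.s g = y)
    (hz : Γ.s k = z) {u : Tan g} (hu : tanMap Γ.s g hy u = 0) :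
    ∃ u' : Tan k, tanMap Γ.s k hz u' = 0 ∧ tanMap Γ.t k hx' u' = tanMap Γ.t g hx u := by
  obtain ⟨p, A, hp, hA, rfl, hps⟩ := hΓ.s_submersion.exists_curve hy hu
  have hcomp : ∀ᶠ τ in 𝓝 0, Γ.s (p τ) = Γ.t h := by
    filter_upwards [hps] with τ hτ
    rw [hτ, ← hy, hgh]
  have hq : PlotAt (fun τ => Γ.mul (p τ) h) univ 0 :=
    hΓ.smooth_mul.plotAt hp (plotAt_const h (mem_univ _)) (by simpa using hcomp)
  have hB := hq.hasVel (x := k) (by simp only [hA.eq, hk])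
  refine ⟨fderiv ℝ (fun w => chartNear k (Γ.mul (p w) h)) 0 1, ?_, ?_⟩
  · have h0 : HasVel (fun _ : ℝ => z) 0 z 0 := ⟨rfl, continuousAt_const, hasFDerivAt_const _ _⟩
    have h1 := (hB.comp_smooth hΓ.s_submersion.1 hz).unique h0 (by
        filter_upwards [hcomp] with τ hτ
        rw [Γ.s_mul hτ, ← hz, ← hk, Γ.s_mul hgh])
    exact DFunLike.congr_fun h1 1
  · have h1 := (hB.comp_smooth hΓ.t_submersion.1 hx').unique
      (hA.comp_smooth hΓ.t_submersion.1 hx) (by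
        filter_upwards [hcomp] with τ hτ
        exact Γ.t_mul hτ)
    exact DFunLike.congr_fun h1 1

/-- The tangent space `F` of the orbit at `t g` may be computed at any arrow `g`. -/
theorem IsLie.map_ker_eq_anchorImage (hΓ : Γ.IsLie) (g : G) {x y : M} (hx : Γ.t g = x)
    (hy : Γ.s g = y) :
    (LinearMap.ker (tanMap Γ.s g hy).toLinearMap).map (tanMap Γ.t g hx).toLinearMap =
      Γ.anchorImage x := by
  apply le_antisymm
  · rintro _ ⟨u, hu, rfl⟩
    obtain ⟨u', h1, h2⟩ := hΓ.exists_translate (g := g) (h := Γ.inv g) (k := Γ.one x)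
      (Γ.t_inv g).symm (by rw [Γ.mul_inv, hx]) hx (Γ.t_one x) hy (Γ.s_one x) hu
    exact ⟨u', h1, h2⟩
  · rintro _ ⟨u, hu, rfl⟩
    obtain ⟨u', h1, h2⟩ := hΓ.exists_translate (g := Γ.one x) (h := g) (k := g)
      (by rw [Γ.s_one, hx]) (by rw [← hx, Γ.one_mul]) (Γ.t_one x) hx (Γ.s_one x) hy hu
    exact ⟨u', h1, h2⟩

/-- For a regular groupoid, the dimension of the kernel of the tangent map of `(s, t)` is locally
constant. -/
theorem IsRegular.finrank_ker_eventually_eq (hΓ : Γ.IsRegular) (g₀ : G) :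
    ∀ᶠ g in 𝓝 g₀, Module.finrank ℝ ↥(LinearMap.ker (tanMap Γ.s g rfl).toLinearMap ⊓
        LinearMap.ker (tanMap Γ.t g rfl).toLinearMap) =
      Module.finrank ℝ ↥(LinearMap.ker (tanMap Γ.s g₀ rfl).toLinearMap ⊓
        LinearMap.ker (tanMap Γ.t g₀ rfl).toLinearMap) := by
  have hdim : ∀ g, Module.finrank ℝ ↥(LinearMap.ker (tanMap Γ.s g rfl).toLinearMap ⊓
        LinearMap.ker (tanMap Γ.t g rfl).toLinearMap) +
        Module.finrank ℝ (Γ.anchorImage (Γ.t g)) + dimAt (Γ.s g) = dimAt g := by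
    intro g
    have h := finrank_ker_inf_ker (tanMap Γ.s g rfl).toLinearMap (tanMap Γ.t g rfl).toLinearMap
      (hΓ.lie.s_submersion.2 g)
    rw [hΓ.lie.map_ker_eq_anchorImage g rfl rfl] at h
    simpa using h
  filter_upwards [dimAt_eventually_eq g₀,
    hΓ.lie.s_submersion.1.continuous.continuousAt.eventually (dimAt_eventually_eq (Γ.s g₀)),
    hΓ.lie.t_submersion.1.continuous.continuousAt.eventually
      (hΓ.rank_locallyConstant.eventually_eq (Γ.t g₀))] with g h1 h2 h3
  have h4 := hdim g
  have h5 := hdim g₀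
  omega

variable {W₁ W₂ Z : Type} [NormedAddCommGroup W₁] [NormedSpace ℝ W₁] [FiniteDimensional ℝ W₁]
  [NormedAddCommGroup W₂] [NormedSpace ℝ W₂] [FiniteDimensional ℝ W₂]
  [NormedAddCommGroup Z] [NormedSpace ℝ Z] [FiniteDimensional ℝ Z]

/-- Coordinates `Ψ` of `G` for which the map `(s, t)` is the composition of the projection to the
first factor with an injective map. The fibers of the projection, the plaques, are balls. Here `c`
and `c'` are coordinates of the base and `φ` is a linear map. -/
structure IsPlaqueCoord {F : Type*} [NormedAddCommGroup F] [NormedSpace ℝ F] (Γ : GroupoidStr M G)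
    (c : OpenPartialHomeomorph M W₁) (c' : OpenPartialHomeomorph M W₂) (φ : W₁ × W₂ →L[ℝ] Z)
    (Ψ : OpenPartialHomeomorph G (Z × F)) (b₀ : Z) (z₀ : F) (r : ℝ) : Prop where
  pos : 0 < r
  coord : IsCoord Ψ
  coord_s : IsCoord c
  coord_t : IsCoord c'
  source : ∀ g ∈ Ψ.source, Γ.s g ∈ c.source ∧ Γ.t g ∈ c'.source
  fst_eq : ∀ g ∈ Ψ.source, (Ψ g).1 = φ (c (Γ.s g), c' (Γ.t g))
  target : Ψ.target = Metric.ball b₀ r ×ˢ Metric.ball z₀ r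
  inj : ∀ g ∈ Ψ.source, ∀ h ∈ Ψ.source, (Ψ g).1 = (Ψ h).1 → Γ.s g = Γ.s h ∧ Γ.t g = Γ.t h

/-- Plaque coordinates exist for any linear map `φ` that is injective on the range of the tangent
map of `(s, t)`, in coordinates of the base. -/
theorem IsRegular.exists_plaque_coord (hΓ : Γ.IsRegular) (g₀ : G)
    {c : OpenPartialHomeomorph M W₁} (hc : IsCoord c) (hs : Γ.s g₀ ∈ c.source)
    {c' : OpenPartialHomeomorph M W₂} (hc' : IsCoord c') (ht : Γ.t g₀ ∈ c'.source)
    {φ : W₁ × W₂ →L[ℝ] Z}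
    (hsurj : ∀ z, ∃ u, φ (dAt c (Γ.s g₀) (tanMap Γ.s g₀ rfl u),
      dAt c' (Γ.t g₀) (tanMap Γ.t g₀ rfl u)) = z)
    (hker : ∀ u, φ (dAt c (Γ.s g₀) (tanMap Γ.s g₀ rfl u),
      dAt c' (Γ.t g₀) (tanMap Γ.t g₀ rfl u)) = 0 →
      tanMap Γ.s g₀ rfl u = 0 ∧ tanMap Γ.t g₀ rfl u = 0) :
    ∃ (F : Submodule ℝ (Tan g₀)) (Ψ : OpenPartialHomeomorph G (Z × F)) (b₀ : Z) (z₀ : F) (r : ℝ),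
      Γ.IsPlaqueCoord c c' φ Ψ b₀ z₀ r ∧ g₀ ∈ Ψ.source := by
  have hss := hΓ.lie.s_submersion.1
  have hts := hΓ.lie.t_submersion.1
  have hN : {g | Γ.s g ∈ c.source ∧ Γ.t g ∈ c'.source} ∈ 𝓝 g₀ :=
    (hss.continuous.continuousAt.eventually (c.open_source.mem_nhds hs)).and
      (hts.continuous.continuousAt.eventually (c'.open_source.mem_nhds ht))
  have hd : ∀ g, Γ.s g ∈ c.source → Γ.t g ∈ c'.source → ∀ u,
      dAt (fun g => (c (Γ.s g), c' (Γ.t g))) g u =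
        (dAt c (Γ.s g) (tanMap Γ.s g rfl u), dAt c' (Γ.t g) (tanMap Γ.t g rfl u)) := by
    intro g h1 h2 u
    rw [dAt_prodMk ((hc.smAt _ h1).comp hss) ((hc'.smAt _ h2).comp hts),
      dAt_comp hss rfl (hc.smAt _ h1), dAt_comp hts rfl (hc'.smAt _ h2)]
  have hk : ∀ g, Γ.s g ∈ c.source → Γ.t g ∈ c'.source →
      LinearMap.ker (dAt (fun g => (c (Γ.s g), c' (Γ.t g))) g).toLinearMap =
        LinearMap.ker (tanMap Γ.s g rfl).toLinearMap ⊓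
          LinearMap.ker (tanMap Γ.t g rfl).toLinearMap := by
    intro g h1 h2
    ext u
    change dAt (fun g => (c (Γ.s g), c' (Γ.t g))) g u = 0 ↔
      tanMap Γ.s g rfl u = 0 ∧ tanMap Γ.t g rfl u = 0
    rw [hd g h1 h2, Prod.mk_eq_zero, map_eq_zero_iff _ (hc.dAt_injective h1),
      map_eq_zero_iff _ (hc'.dAt_injective h2)]
  obtain ⟨F, Ψ, r, hr, hΨ, hg₀, hO, h1, htar, h2⟩ := exists_constantRank_coord
    (f := fun g => (c (Γ.s g), c' (Γ.t g))) (φ := φ) hN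
    (Filter.eventually_of_mem hN fun g hg =>
      ((hc.smAt _ hg.1).comp hss).prodMk ((hc'.smAt _ hg.2).comp hts))
    (by
      filter_upwards [hN, hΓ.finrank_ker_eventually_eq g₀] with g hg h
      rw [hk g hg.1 hg.2, hk g₀ hs ht, h])
    (fun z => by simpa only [hd g₀ hs ht] using hsurj z)
    (fun u hu => by
      rw [hd g₀ hs ht] at hu ⊢
      rw [(hker u hu).1, (hker u hu).2]
      simp)
  refine ⟨F, Ψ, _, _, r, ⟨hr, hΨ, hc, hc', hO, h1, htar, fun g hg h hh e => ?_⟩, hg₀⟩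
  have := h2 g hg h hh (by rw [← h1 g hg, ← h1 h hh, e])
  rw [Prod.mk.injEq] at this
  exact ⟨c.injOn (hO hg).1 (hO hh).1 this.1, c'.injOn (hO hg).2 (hO hh).2 this.2⟩

/-- Every linear map `D` has a projection to its range as a left inverse on the range. -/
theorem exists_linear_coord {U W : Type*} [AddCommGroup U] [Module ℝ U]
    [NormedAddCommGroup W] [NormedSpace ℝ W] [FiniteDimensional ℝ W] (D : U →ₗ[ℝ] W) :
    ∃ φ : W →L[ℝ] LinearMap.range D, (∀ z, ∃ u, φ (D u) = z) ∧ ∀ u, φ (D u) = 0 → D u = 0 := by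
  obtain ⟨P, hP⟩ := LinearMap.exists_leftInverse_of_injective (LinearMap.range D).subtype
    (Submodule.ker_subtype _)
  have h : ∀ u, P (D u) = ⟨D u, u, rfl⟩ := fun u => DFunLike.congr_fun hP ⟨D u, u, rfl⟩
  refine ⟨LinearMap.toContinuousLinearMap P, ?_, fun u hu => ?_⟩
  · rintro ⟨_, u, rfl⟩
    exact ⟨u, h u⟩
  · exact congrArg Subtype.val ((h u).symm.trans hu)

/-- Every arrow has plaque coordinates around it. -/
theorem IsRegular.exists_plaque_coord_chart (hΓ : Γ.IsRegular) (g₀ : G) :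
    ∃ (Z : Type) (_ : NormedAddCommGroup Z) (_ : NormedSpace ℝ Z) (_ : FiniteDimensional ℝ Z)
      (φ : Tan (Γ.s g₀) × Tan (Γ.t g₀) →L[ℝ] Z) (F : Submodule ℝ (Tan g₀))
      (Ψ : OpenPartialHomeomorph G (Z × F)) (b₀ : Z) (z₀ : F) (r : ℝ),
      Γ.IsPlaqueCoord (chartNear (Γ.s g₀)) (chartNear (Γ.t g₀)) φ Ψ b₀ z₀ r ∧ g₀ ∈ Ψ.source := by
  have hs := mem_chartNear_source (Γ.s g₀)
  have ht := mem_chartNear_source (Γ.t g₀)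
  have hc := isCoord_chart (chartNear_mem (Γ.s g₀))
  have hc' := isCoord_chart (chartNear_mem (Γ.t g₀))
  obtain ⟨φ, h1, h2⟩ := exists_linear_coord
    (((dAt (chartNear (Γ.s g₀)) (Γ.s g₀)) ∘L (tanMap Γ.s g₀ rfl)).prod
      ((dAt (chartNear (Γ.t g₀)) (Γ.t g₀)) ∘L (tanMap Γ.t g₀ rfl))).toLinearMap
  obtain ⟨F, Ψ, b₀, z₀, r, hΨ⟩ := hΓ.exists_plaque_coord g₀ hc hs hc' ht (φ := φ) h1 (fun u hu => by
    have h3 := Prod.mk_eq_zero.1 (h2 u hu)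
    exact ⟨(map_eq_zero_iff _ (hc.dAt_injective hs)).1 h3.1,
      (map_eq_zero_iff _ (hc'.dAt_injective ht)).1 h3.2⟩)
  exact ⟨_, _, _, inferInstance, φ, F, Ψ, b₀, z₀, r, hΨ⟩

end LieGroupoids

end GroupoidStr

/-! ### Quotient manifolds -/

section QuotientManifold

variable {X : Type u} [TopologicalSpace X] [SmoothManifold X]
variable {Y : Type v} [TopologicalSpace Y]

/-- A local coordinate system of `Y` for which `π : X → Y` is a submersion: it is smooth when
composed with `π`, and its inverse lifts along `π`, through any given point. -/
structure IsQuotientCoord {W : Type*} [NormedAddCommGroup W] [NormedSpace ℝ W] (π : X → Y)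
    (c : OpenPartialHomeomorph Y W) : Prop where
  smAt : ∀ x, π x ∈ c.source → SmAt (fun x => c (π x)) x
  lift : ∀ x, π x ∈ c.source → ∃ p : W → X, PlotAt p univ (c (π x)) ∧ p (c (π x)) = x ∧
    ∀ᶠ w in 𝓝 (c (π x)), π (p w) = c.symm w

/-- The smooth structure on `Y` for which `π : X → Y` is a submersion. -/
@[reducible] def quotientManifold (π : X → Y) (hπ : Function.Surjective π)
    (h : ∀ y, ∃ (n : ℕ) (c : OpenPartialHomeomorph Y (Euc n)), IsQuotientCoord π c ∧ y ∈ c.source) :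
    SmoothManifold Y where
  charts n := {c | IsQuotientCoord π c}
  exists_chart y := h y
  compatible := by
    rintro n k c hc d hd w ⟨hw, hw'⟩
    obtain ⟨x, hx⟩ := hπ (c.symm w)
    have hxc : π x ∈ c.source := by
      rw [hx]
      exact c.map_target hw
    have hxd : π x ∈ d.source := by
      rw [hx]
      exact hw'
    obtain ⟨p, hp, hpx, hev⟩ := hc.lift x hxc
    have e : c (π x) = w := by rw [hx, c.right_inv hw]
    rw [e] at hp hpx hev
    refine ContDiffAt.contDiffWithinAt ?_
    refine ((hd.smAt x hxd).comp_plot_univ hp hpx).congr_of_eventuallyEq ?_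
    filter_upwards [hev] with w hw
    simp [hw]

theorem IsQuotientCoord.equiv {W V : Type*} [NormedAddCommGroup W] [NormedSpace ℝ W]
    [NormedAddCommGroup V] [NormedSpace ℝ V] {π : X → Y} {c : OpenPartialHomeomorph Y W}
    (hc : IsQuotientCoord π c) (L : W ≃L[ℝ] V) :
    IsQuotientCoord π (c.transHomeomorph L.toHomeomorph) := by
  refine ⟨fun x hx => (hc.smAt x hx).post L.contDiff.contDiffAt, fun x hx => ?_⟩
  obtain ⟨p, hp, hpx, hev⟩ := hc.lift x hx
  have e : L.symm (L (c (π x))) = c (π x) := L.symm_apply_apply _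
  refine ⟨fun v => p (L.symm v), ?_, ?_, ?_⟩
  · refine PlotAt.comp (p := p) (S := univ) ?_ L.symm.contDiff.contDiffAt.contDiffWithinAt
      (mem_univ _) (mapsTo_univ _ _)
    exact e.symm ▸ hp
  · change p (L.symm (L (c (π x)))) = x
    rw [e, hpx]
  · have h1 : ContinuousAt L.symm (L (c (π x))) := L.symm.continuous.continuousAt
    exact h1.eventually (p := fun w => π (p w) = c.symm w) (by rwa [e])

theorem quotientManifold_isSubmersion {π : X → Y} (hπ : Function.Surjective π)
    (hcont : Continuous π)
    (h : ∀ y, ∃ (n : ℕ) (c : OpenPartialHomeomorph Y (Euc n)), IsQuotientCoord π c ∧ y ∈ c.source) :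
    letI := quotientManifold π hπ h
    IsSubmersion π := by
  let := quotientManifold π hπ h
  have hsm : Smooth π := by
    refine smooth_of_plots fun m p v hp => ?_
    obtain ⟨n, c, hc, hx⟩ := h (π (p v))
    exact PlotAt.of_chart (c := c) hc (mem_univ _)
      (hcont.continuousAt.comp_continuousWithinAt hp.cont) hx
      ((hc.smAt (p v) hx).comp_plot hp)
  refine isSubmersion_of_lift hsm fun m p v x hp hx => ?_
  obtain ⟨n, c, hc, hxc⟩ := h (π x)
  obtain ⟨q, hq, hqx, hev⟩ := hc.lift x hxc
  have hpc : p v ∈ c.source := by rwa [← hx]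
  have h1 : ContDiffAt ℝ ∞ (fun w => c (p w)) v :=
    contDiffWithinAt_univ.1 (hp.smooth c hc hpc)
  refine ⟨fun w => q (c (p w)), ?_, ?_, ?_⟩
  · exact PlotAt.comp (p := q) (S := univ) (g := fun w => c (p w)) (by rwa [← hx])
      h1.contDiffWithinAt (mem_univ _) (mapsTo_univ _ _)
  · simp only [← hx, hqx]
  · rw [hx] at hev
    have h2 := h1.continuousAt.eventually (p := fun w => π (q w) = c.symm w) hev
    filter_upwards [h2, hp.continuousAt.eventually (c.open_source.mem_nhds hpc)] with w hw hw'
    rw [hw, c.left_inv hw']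

theorem IsQuotientCoord.isCoord {W : Type} [NormedAddCommGroup W] [NormedSpace ℝ W]
    [SmoothManifold Y] {π : X → Y} (hπ : IsSubmersion π) (hs : Function.Surjective π)
    {c : OpenPartialHomeomorph Y W} (hc : IsQuotientCoord π c) : IsCoord c := by
  refine ⟨fun y hy => SmAt.of_plots fun n p v hp hpy => ?_, fun w hw => ?_⟩
  · obtain ⟨x, rfl⟩ := hs y
    obtain ⟨q, hq, hqx, hev⟩ := hπ.exists_lift hp hpy.symm
    rw [nhdsWithin_univ] at hev
    refine ((hc.smAt x hy).comp_plot_univ hq hqx).congr_of_eventuallyEq ?_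
    filter_upwards [hev] with w hw
    rw [hw]
  · obtain ⟨x, hx⟩ := hs (c.symm w)
    obtain ⟨p, hp, -, hev⟩ := hc.lift x (by rw [hx]; exact c.map_target hw)
    rw [hx, c.right_inv hw] at hp hev
    refine (hπ.1.plotAt hp).congr ?_
    rw [nhdsWithin_univ]
    exact hev.mono fun w hw => hw.symm

end QuotientManifold

/-! ### The quotient of a groupoid by the identity components of its isotropy groups -/

namespace GroupoidStr

section Components

variable {M : Type u} {G : Type v} [TopologicalSpace G] (Γ : GroupoidStr M G)

/-- The arrows from `x` to `y`. -/
def arrowsFrom (x y : M) : Set G := {g | Γ.s g = x ∧ Γ.t g = y}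

/-- The connected component of `g` in the space of all arrows with the same source and target. -/
def component (g : G) : Set G := connectedComponentIn (Γ.arrowsFrom (Γ.s g) (Γ.t g)) g

variable {Γ}

theorem mem_component_self (g : G) : g ∈ Γ.component g :=
  mem_connectedComponentIn ⟨rfl, rfl⟩

theorem isPreconnected_component (g : G) : IsPreconnected (Γ.component g) :=
  isPreconnected_connectedComponentIn

theorem s_t_of_mem_component {g h : G} (hh : h ∈ Γ.component g) :
    Γ.s h = Γ.s g ∧ Γ.t h = Γ.t g :=
  connectedComponentIn_subset (Γ.arrowsFrom (Γ.s g) (Γ.t g)) g hh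

theorem component_eq {g h : G} (hh : h ∈ Γ.component g) : Γ.component h = Γ.component g := by
  obtain ⟨h1, h2⟩ := s_t_of_mem_component hh
  unfold component at hh ⊢
  rw [h1, h2, connectedComponentIn_eq hh]

theorem mem_component_of_isPreconnected {C : Set G} (hC : IsPreconnected C) {g h : G}
    (hg : g ∈ C) (hh : h ∈ C) (hst : ∀ k ∈ C, Γ.s k = Γ.s g ∧ Γ.t k = Γ.t g) :
    h ∈ Γ.component g :=
  hC.subset_connectedComponentIn hg hst hh

variable (Γ)

/-- Two arrows are equivalent if they have the same source and target and lie in the same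
connected component of the space of such arrows. -/
@[reducible] def componentSetoid : Setoid G where
  r g h := h ∈ Γ.component g
  iseqv := by
    refine ⟨mem_component_self, fun {g h} hh => ?_, fun {g h k} hh hk => ?_⟩
    · rw [component_eq hh]
      exact mem_component_self g
    · rwa [component_eq hh] at hk

/-- The space of connected components of the fibers of `(s, t)`. -/
abbrev ComponentSpace : Type v := Quotient Γ.componentSetoid

/-- The quotient map to the space of components. -/
def toComponent (g : G) : Γ.ComponentSpace := Quotient.mk Γ.componentSetoid g

variable {Γ}

theorem toComponent_surjective : Function.Surjective Γ.toComponent := Quotient.mk_surjective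

theorem continuous_toComponent : Continuous Γ.toComponent := continuous_quotient_mk'

theorem toComponent_eq_iff {g h : G} : Γ.toComponent g = Γ.toComponent h ↔ h ∈ Γ.component g :=
  Quotient.eq (r := Γ.componentSetoid)

theorem preimage_toComponent (g : G) : Γ.toComponent ⁻¹' {Γ.toComponent g} = Γ.component g := by
  ext h
  rw [mem_preimage, mem_singleton_iff, eq_comm, toComponent_eq_iff]

theorem isConnected_fiber_toComponent (e : Γ.ComponentSpace) :
    IsConnected (Γ.toComponent ⁻¹' {e}) := by
  obtain ⟨g, rfl⟩ := toComponent_surjective e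
  rw [preimage_toComponent]
  exact ⟨⟨g, mem_component_self g⟩, isPreconnected_component g⟩

/-- The identity components of the isotropy groups form the kernel of the quotient map. -/
theorem mem_isotropyIdentity_iff {g : G} :
    g ∈ Γ.isotropyIdentity ↔ ∃ x, Γ.toComponent g = Γ.toComponent (Γ.one x) := by
  refine exists_congr fun x => ?_
  have h : Γ.isotropy x = Γ.arrowsFrom (Γ.s (Γ.one x)) (Γ.t (Γ.one x)) := by
    rw [Γ.s_one, Γ.t_one]
    rfl
  rw [eq_comm, toComponent_eq_iff, h]
  rfl

end Components

section RegularQuotient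

variable {M : Type u} [TopologicalSpace M] [SmoothManifold M]
variable {G : Type v} [TopologicalSpace G] [SmoothManifold G] {Γ : GroupoidStr M G}

theorem IsLie.mul_mem_component (hΓ : Γ.IsLie) {g g' h h' : G} (hgh : Γ.s g = Γ.t h)
    (hg : g' ∈ Γ.component g) (hh : h' ∈ Γ.component h) :
    Γ.mul g' h' ∈ Γ.component (Γ.mul g h) := by
  have hst : ∀ p ∈ Γ.component g ×ˢ Γ.component h, Γ.s p.1 = Γ.t p.2 := by
    rintro p ⟨h1, h2⟩
    rw [(s_t_of_mem_component h1).1, (s_t_of_mem_component h2).2, hgh]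
  have hC := ((isPreconnected_component g).prod (isPreconnected_component h)).image
    (fun p : G × G => Γ.mul p.1 p.2) (hΓ.smooth_mul.1.mono hst)
  refine mem_component_of_isPreconnected hC
    ⟨(g, h), ⟨mem_component_self g, mem_component_self h⟩, rfl⟩ ⟨(g', h'), ⟨hg, hh⟩, rfl⟩ ?_
  rintro _ ⟨p, hp, rfl⟩
  rw [Γ.s_mul (hst p hp), Γ.t_mul (hst p hp), Γ.s_mul hgh, Γ.t_mul hgh]
  exact ⟨(s_t_of_mem_component hp.2).1, (s_t_of_mem_component hp.1).2⟩

theorem IsLie.inv_mem_component (hΓ : Γ.IsLie) {g g' : G} (hg : g' ∈ Γ.component g) :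
    Γ.inv g' ∈ Γ.component (Γ.inv g) := by
  refine mem_component_of_isPreconnected
    ((isPreconnected_component g).image Γ.inv hΓ.smooth_inv.continuous.continuousOn)
    ⟨g, mem_component_self g, rfl⟩ ⟨g', hg, rfl⟩ ?_
  rintro _ ⟨k, hk, rfl⟩
  simp only [Γ.s_inv, Γ.t_inv]
  exact ⟨(s_t_of_mem_component hk).2, (s_t_of_mem_component hk).1⟩

variable (Γ)

/-- The quotient groupoid. The product of components is represented by the product of arbitrary
representatives. -/
noncomputable def quotient (hΓ : Γ.IsLie) : GroupoidStr M Γ.ComponentSpace := by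
  have hs : ∀ g h : G, h ∈ Γ.component g → Γ.s g = Γ.s h :=
    fun g h hh => (s_t_of_mem_component hh).1.symm
  have ht : ∀ g h : G, h ∈ Γ.component g → Γ.t g = Γ.t h :=
    fun g h hh => (s_t_of_mem_component hh).2.symm
  let s : Γ.ComponentSpace → M := Quotient.lift Γ.s hs
  let t : Γ.ComponentSpace → M := Quotient.lift Γ.t ht
  let mul : Γ.ComponentSpace → Γ.ComponentSpace → Γ.ComponentSpace :=
    fun e f => Γ.toComponent (Γ.mul e.out f.out)
  let inv : Γ.ComponentSpace → Γ.ComponentSpace := fun e => Γ.toComponent (Γ.inv e.out)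
  have hmul : ∀ g h, Γ.s g = Γ.t h →
      mul (Γ.toComponent g) (Γ.toComponent h) = Γ.toComponent (Γ.mul g h) := by
    intro g h hgh
    refine (toComponent_eq_iff.2 (hΓ.mul_mem_component hgh ?_ ?_)).symm
    · exact toComponent_eq_iff.1 (Quotient.out_eq (Γ.toComponent g)).symm
    · exact toComponent_eq_iff.1 (Quotient.out_eq (Γ.toComponent h)).symm
  have hinv : ∀ g, inv (Γ.toComponent g) = Γ.toComponent (Γ.inv g) := by
    intro g
    refine (toComponent_eq_iff.2 (hΓ.inv_mem_component ?_)).symm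
    exact toComponent_eq_iff.1 (Quotient.out_eq (Γ.toComponent g)).symm
  exact
  { s := s
    t := t
    mul := mul
    inv := inv
    one := fun x => Γ.toComponent (Γ.one x)
    s_mul := by
      intro e f h
      obtain ⟨g, rfl⟩ := toComponent_surjective e
      obtain ⟨k, rfl⟩ := toComponent_surjective f
      rw [hmul g k h]
      exact Γ.s_mul h
    t_mul := by
      intro e f h
      obtain ⟨g, rfl⟩ := toComponent_surjective e
      obtain ⟨k, rfl⟩ := toComponent_surjective f
      rw [hmul g k h]
      exact Γ.t_mul h
    mul_assoc := by
      intro e f f' h h'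
      obtain ⟨g, rfl⟩ := toComponent_surjective e
      obtain ⟨k, rfl⟩ := toComponent_surjective f
      obtain ⟨k', rfl⟩ := toComponent_surjective f'
      have h1 : Γ.s g = Γ.t k := h
      have h2 : Γ.s k = Γ.t k' := h'
      rw [hmul g k h, hmul k k' h', hmul _ _ (by rw [Γ.s_mul h1, h2]),
        hmul _ _ (by rw [Γ.t_mul h2, h1]), Γ.mul_assoc h1 h2]
    s_one := Γ.s_one
    t_one := Γ.t_one
    one_mul := by
      intro e
      obtain ⟨g, rfl⟩ := toComponent_surjective e
      change mul (Γ.toComponent (Γ.one (Γ.t g))) _ = _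
      rw [hmul _ _ (Γ.s_one _), Γ.one_mul]
    mul_one := by
      intro e
      obtain ⟨g, rfl⟩ := toComponent_surjective e
      change mul _ (Γ.toComponent (Γ.one (Γ.s g))) = _
      rw [hmul _ _ (Γ.t_one _).symm, Γ.mul_one]
    s_inv := by
      intro e
      obtain ⟨g, rfl⟩ := toComponent_surjective e
      rw [hinv]
      exact Γ.s_inv g
    t_inv := by
      intro e
      obtain ⟨g, rfl⟩ := toComponent_surjective e
      rw [hinv]
      exact Γ.t_inv g
    inv_mul := by
      intro e
      obtain ⟨g, rfl⟩ := toComponent_surjective e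
      rw [hinv, hmul _ _ (Γ.s_inv g), Γ.inv_mul]
      rfl
    mul_inv := by
      intro e
      obtain ⟨g, rfl⟩ := toComponent_surjective e
      rw [hinv, hmul _ _ (Γ.t_inv g).symm, Γ.mul_inv]
      rfl }

variable {Γ}

theorem isHom_toComponent (hΓ : Γ.IsLie) : Γ.IsHom (Γ.quotient hΓ) Γ.toComponent where
  s_map _ := rfl
  t_map _ := rfl
  map_mul g h hgh := by
    refine toComponent_eq_iff.2 (hΓ.mul_mem_component hgh ?_ ?_)
    · exact toComponent_eq_iff.1 (Quotient.out_eq (Γ.toComponent g)).symm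
    · exact toComponent_eq_iff.1 (Quotient.out_eq (Γ.toComponent h)).symm
  map_inv g := by
    refine toComponent_eq_iff.2 (hΓ.inv_mem_component ?_)
    exact toComponent_eq_iff.1 (Quotient.out_eq (Γ.toComponent g)).symm
  map_one _ := rfl

theorem IsLie.toComponent_eq_iff_exists_mul (hΓ : Γ.IsLie) (g h : G) :
    Γ.toComponent g = Γ.toComponent h ↔
      ∃ k ∈ Γ.isotropyIdentity, Γ.s g = Γ.t k ∧ h = Γ.mul g k := by
  constructor
  · intro e
    have hh := toComponent_eq_iff.1 e
    obtain ⟨h1, h2⟩ := s_t_of_mem_component hh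
    have h3 : Γ.s (Γ.inv g) = Γ.t h := by rw [Γ.s_inv, h2]
    refine ⟨Γ.mul (Γ.inv g) h, mem_isotropyIdentity_iff.2 ⟨Γ.s g, ?_⟩, ?_, ?_⟩
    · have h4 := hΓ.mul_mem_component (Γ.s_inv g) (mem_component_self (Γ.inv g)) hh
      rw [Γ.inv_mul] at h4
      exact (toComponent_eq_iff.2 h4).symm
    · rw [Γ.t_mul h3, Γ.t_inv]
    · rw [← Γ.mul_assoc (Γ.t_inv g).symm h3, Γ.mul_inv, ← h2, Γ.one_mul]
  · rintro ⟨k, hk, hgk, rfl⟩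
    obtain ⟨x, hx⟩ := mem_isotropyIdentity_iff.1 hk
    have h1 := toComponent_eq_iff.1 hx.symm
    have h2 : Γ.s g = x := by
      rw [hgk, (s_t_of_mem_component h1).2, Γ.t_one]
    subst h2
    have h4 := hΓ.mul_mem_component (Γ.t_one (Γ.s g)).symm (mem_component_self g) h1
    rw [Γ.mul_one] at h4
    exact toComponent_eq_iff.2 h4

end RegularQuotient

/-! ### The smooth structure of the quotient groupoid -/

section QuotientChart

variable {M : Type u} [TopologicalSpace M] [SmoothManifold M]
variable {G : Type v} [TopologicalSpace G] [SmoothManifold G] {Γ : GroupoidStr M G}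
variable {W₁ W₂ Z : Type} [NormedAddCommGroup W₁] [NormedSpace ℝ W₁]
  [NormedAddCommGroup W₂] [NormedSpace ℝ W₂]
  [NormedAddCommGroup Z] [NormedSpace ℝ Z]
  {F : Type*} [NormedAddCommGroup F] [NormedSpace ℝ F]
  {c : OpenPartialHomeomorph M W₁} {c' : OpenPartialHomeomorph M W₂} {φ : W₁ × W₂ →L[ℝ] Z}
  {Ψ : OpenPartialHomeomorph G (Z × F)} {b₀ : Z} {z₀ : F} {r : ℝ}

theorem IsPlaqueCoord.mk_mem_target (hΨ : Γ.IsPlaqueCoord c c' φ Ψ b₀ z₀ r) {g h : G}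
    (hg : g ∈ Ψ.source) (hh : h ∈ Ψ.source) : ((Ψ g).1, (Ψ h).2) ∈ Ψ.target := by
  have h1 := Ψ.map_source hg
  have h2 := Ψ.map_source hh
  rw [hΨ.target] at h1 h2 ⊢
  exact ⟨h1.1, h2.2⟩

/-- Arrows in the same plaque lie in the same component, as plaques are connected. -/
theorem IsPlaqueCoord.mem_component (hΨ : Γ.IsPlaqueCoord c c' φ Ψ b₀ z₀ r) {g h : G}
    (hg : g ∈ Ψ.source) (hh : h ∈ Ψ.source) (e : (Ψ g).1 = (Ψ h).1) : h ∈ Γ.component g := by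
  have hgt := Ψ.map_source hg
  have hht := Ψ.map_source hh
  have hsub : {(Ψ g).1} ×ˢ Metric.ball z₀ r ⊆ Ψ.target := by
    rw [hΨ.target] at hgt ⊢
    rintro ⟨b, z⟩ ⟨hb, hz⟩
    rw [mem_singleton_iff] at hb
    exact ⟨by rw [hb]; exact hgt.1, hz⟩
  have hC := (isPreconnected_singleton.prod
    (convex_ball z₀ r).isPreconnected).image Ψ.symm (Ψ.continuousOn_symm.mono hsub)
  rw [hΨ.target] at hgt hht
  refine mem_component_of_isPreconnected hC ⟨Ψ g, ⟨rfl, hgt.2⟩, Ψ.left_inv hg⟩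
    ⟨Ψ h, ⟨e.symm, hht.2⟩, Ψ.left_inv hh⟩ ?_
  rintro _ ⟨v, hv, rfl⟩
  refine hΨ.inj _ (Ψ.map_target (hsub hv)) _ hg ?_
  rw [Ψ.right_inv (hsub hv)]
  exact hv.1

theorem IsPlaqueCoord.fst_eq_of_mem_component (hΨ : Γ.IsPlaqueCoord c c' φ Ψ b₀ z₀ r) {g h : G}
    (hg : g ∈ Ψ.source) (hh : h ∈ Ψ.source) (e : h ∈ Γ.component g) : (Ψ g).1 = (Ψ h).1 := by
  rw [hΨ.fst_eq g hg, hΨ.fst_eq h hh, (s_t_of_mem_component e).1, (s_t_of_mem_component e).2]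

/-- If a union of components is a neighborhood of one point of a plaque, it is a neighborhood of
all points of the plaque. -/
theorem IsPlaqueCoord.mem_nhds (hΨ : Γ.IsPlaqueCoord c c' φ Ψ b₀ z₀ r) {S : Set G}
    (hS : ∀ g ∈ S, Γ.component g ⊆ S) {g h : G} (hg : g ∈ Ψ.source) (hh : h ∈ Ψ.source)
    (e : (Ψ g).1 = (Ψ h).1) (hgS : S ∈ 𝓝 g) : S ∈ 𝓝 h := by
  have hgh : ((Ψ h).1, (Ψ g).2) = Ψ g := by rw [← e]
  have ht := Ψ.map_source hg
  have hm : ContinuousAt (fun k => Ψ.symm ((Ψ k).1, (Ψ g).2)) h := by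
    refine ContinuousAt.comp (g := Ψ.symm) (f := fun k => ((Ψ k).1, (Ψ g).2)) ?_
      ((continuousAt_fst.comp (Ψ.continuousAt hh)).prodMk continuousAt_const)
    rw [hgh]
    exact Ψ.continuousAt_symm ht
  have hmS : ∀ᶠ k in 𝓝 h, Ψ.symm ((Ψ k).1, (Ψ g).2) ∈ S :=
    hm.eventually (p := fun k => k ∈ S) (by
      change S ∈ 𝓝 (Ψ.symm ((Ψ h).1, (Ψ g).2))
      rw [hgh, Ψ.left_inv hg]
      exact hgS)
  filter_upwards [hmS, Ψ.open_source.mem_nhds hh] with k hk hk'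
  have h1 := hΨ.mk_mem_target hk' hg
  refine hS _ hk (hΨ.mem_component (Ψ.map_target h1) hk' ?_)
  rw [Ψ.right_inv h1]

/-- The quotient map is open: the components are chains of plaques. -/
theorem IsRegular.isOpenMap_toComponent (hΓ : Γ.IsRegular) : IsOpenMap Γ.toComponent := by
  intro U hU
  refine isOpen_coinduced.2 ?_
  change IsOpen (Γ.toComponent ⁻¹' (Γ.toComponent '' U))
  set S := Γ.toComponent ⁻¹' (Γ.toComponent '' U)
  have hS : ∀ g ∈ S, Γ.component g ⊆ S := by
    rintro g ⟨u, hu, hug⟩ h hh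
    exact ⟨u, hu, hug.trans (toComponent_eq_iff.2 hh)⟩
  rw [isOpen_iff_mem_nhds]
  rintro g ⟨u, hu, hug⟩
  have hg : g ∈ Γ.component u := toComponent_eq_iff.1 hug
  have huS : S ∈ 𝓝 u :=
    Filter.mem_of_superset (hU.mem_nhds hu) fun k hk => ⟨k, hk, rfl⟩
  refine ((isPreconnected_component u).induction₂ (fun a b => S ∈ 𝓝 a ↔ S ∈ 𝓝 b) ?_
    (fun _ _ _ _ _ _ h1 h2 => h1.trans h2) (fun _ _ _ _ h => h.symm)
    (mem_component_self u) hg).1 huS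
  intro a ha
  obtain ⟨Z, _, _, _, φ, F, Ψ, b₀, z₀, r, hΨ, haΨ⟩ := hΓ.exists_plaque_coord_chart a
  filter_upwards [mem_nhdsWithin_of_mem_nhds (Ψ.open_source.mem_nhds haΨ),
    self_mem_nhdsWithin] with b hbΨ hb
  have e : (Ψ a).1 = (Ψ b).1 := by
    refine hΨ.fst_eq_of_mem_component haΨ hbΨ ?_
    rwa [component_eq ha]
  exact ⟨hΨ.mem_nhds hS haΨ hbΨ e, hΨ.mem_nhds hS hbΨ haΨ e.symm⟩

theorem continuous_quotient_s (hΓ : Γ.IsLie) : Continuous (Γ.quotient hΓ).s :=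
  continuous_coinduced_dom.2 hΓ.s_submersion.1.continuous

theorem continuous_quotient_t (hΓ : Γ.IsLie) : Continuous (Γ.quotient hΓ).t :=
  continuous_coinduced_dom.2 hΓ.t_submersion.1.continuous

/-- The coordinates of the quotient given by plaque coordinates: the coordinate of a plaque. -/
noncomputable def IsPlaqueCoord.quotientCoord (hΨ : Γ.IsPlaqueCoord c c' φ Ψ b₀ z₀ r)
    (hΓ : Γ.IsRegular) : OpenPartialHomeomorph Γ.ComponentSpace Z := by
  have key : ∀ g ∈ Ψ.source, ((Ψ g).1, z₀) ∈ Ψ.target := by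
    intro g hg
    have h1 := Ψ.map_source hg
    rw [hΨ.target] at h1 ⊢
    exact ⟨h1.1, Metric.mem_ball_self hΨ.pos⟩
  have key' : ∀ b ∈ Metric.ball b₀ r, (b, z₀) ∈ Ψ.target := by
    intro b hb
    rw [hΨ.target]
    exact ⟨hb, Metric.mem_ball_self hΨ.pos⟩
  exact
  { toFun := fun e => φ (c ((Γ.quotient hΓ.lie).s e), c' ((Γ.quotient hΓ.lie).t e))
    invFun := fun b => Γ.toComponent (Ψ.symm (b, z₀))
    source := Γ.toComponent '' Ψ.source
    target := Metric.ball b₀ r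
    map_source' := by
      rintro _ ⟨g, hg, rfl⟩
      have h1 := Ψ.map_source hg
      rw [hΨ.target] at h1
      change φ (c (Γ.s g), c' (Γ.t g)) ∈ _
      rw [← hΨ.fst_eq g hg]
      exact h1.1
    map_target' := fun b hb => ⟨_, Ψ.map_target (key' b hb), rfl⟩
    left_inv' := by
      rintro _ ⟨g, hg, rfl⟩
      change Γ.toComponent (Ψ.symm (φ (c (Γ.s g), c' (Γ.t g)), z₀)) = Γ.toComponent g
      rw [← hΨ.fst_eq g hg]
      refine toComponent_eq_iff.2 (hΨ.mem_component (Ψ.map_target (key g hg)) hg ?_)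
      rw [Ψ.right_inv (key g hg)]
    right_inv' := by
      intro b hb
      change φ (c (Γ.s _), c' (Γ.t _)) = b
      rw [← hΨ.fst_eq _ (Ψ.map_target (key' b hb)), Ψ.right_inv (key' b hb)]
    open_source := hΓ.isOpenMap_toComponent _ Ψ.open_source
    open_target := Metric.isOpen_ball
    continuousOn_toFun := by
      refine φ.continuous.comp_continuousOn (ContinuousOn.prodMk ?_ ?_)
      · refine c.continuousOn.comp (continuous_quotient_s hΓ.lie).continuousOn ?_
        rintro _ ⟨g, hg, rfl⟩
        exact (hΨ.source g hg).1
      · refine c'.continuousOn.comp (continuous_quotient_t hΓ.lie).continuousOn ?_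
        rintro _ ⟨g, hg, rfl⟩
        exact (hΨ.source g hg).2
    continuousOn_invFun := by
      refine continuous_toComponent.comp_continuousOn (Ψ.continuousOn_symm.comp
        (Continuous.continuousOn (by fun_prop)) key') }

theorem IsPlaqueCoord.mem_quotientCoord_source (hΨ : Γ.IsPlaqueCoord c c' φ Ψ b₀ z₀ r)
    (hΓ : Γ.IsRegular) {g : G} (hg : g ∈ Ψ.source) :
    Γ.toComponent g ∈ (hΨ.quotientCoord hΓ).source := ⟨g, hg, rfl⟩

theorem IsPlaqueCoord.isQuotientCoord (hΨ : Γ.IsPlaqueCoord c c' φ Ψ b₀ z₀ r)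
    (hΓ : Γ.IsRegular) : IsQuotientCoord Γ.toComponent (hΨ.quotientCoord hΓ) := by
  have hss := hΓ.lie.s_submersion.1
  have hts := hΓ.lie.t_submersion.1
  refine ⟨?_, ?_⟩
  · rintro g ⟨g', hg', hgg'⟩
    obtain ⟨h1, h2⟩ := s_t_of_mem_component (toComponent_eq_iff.1 hgg')
    obtain ⟨h3, h4⟩ := hΨ.source g' hg'
    rw [← h1] at h3
    rw [← h2] at h4
    exact (((hΨ.coord_s.smAt _ h3).comp hss).prodMk ((hΨ.coord_t.smAt _ h4).comp hts)).post
      φ.contDiff.contDiffAt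
  -- through `g` there is a lift defined by plaque coordinates around `g`
  intro g hg
  set C := hΨ.quotientCoord hΓ with hC
  obtain ⟨Z', _, _, _, φ', F', Ψ', b₀', z₀', r', hΨ', hgΨ'⟩ := hΓ.exists_plaque_coord_chart g
  set d := chartNear (Γ.s g)
  set d' := chartNear (Γ.t g)
  have hCt : C (Γ.toComponent g) ∈ C.target := C.map_source hg
  have hσt : ∀ w ∈ C.target, (w, z₀) ∈ Ψ.target := by
    intro w hw
    rw [hΨ.target]
    exact ⟨hw, Metric.mem_ball_self hΨ.pos⟩
  set σ : Z → G := fun w => Ψ.symm (w, z₀) with hσ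
  have hπσ : ∀ w, Γ.toComponent (σ w) = C.symm w := fun w => rfl
  have hσp : PlotAt σ univ (C (Γ.toComponent g)) :=
    hΨ.coord.plotAt_symm (contDiffWithinAt_id.prodMk contDiffWithinAt_const) (mem_univ _)
      (hσt _ hCt)
  obtain ⟨hs1, ht1⟩ := s_t_of_mem_component (toComponent_eq_iff.1
    (((hπσ _).trans (C.left_inv hg)).symm))
  set q : Z → Z' := fun w => φ' (d (Γ.s (σ w)), d' (Γ.t (σ w))) with hq
  have hq0 : (q (C (Γ.toComponent g)), (Ψ' g).2) = Ψ' g := by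
    refine Prod.ext ?_ rfl
    simp only [hq, hs1, ht1]
    exact (hΨ'.fst_eq g hgΨ').symm
  have hqs : ContDiffAt ℝ ∞ q (C (Γ.toComponent g)) := by
    have h1 : SmAt (fun h => φ' (d (Γ.s h), d' (Γ.t h))) (σ (C (Γ.toComponent g))) := by
      refine (SmAt.prodMk ((hΨ'.coord_s.smAt _ ?_).comp hss)
        ((hΨ'.coord_t.smAt _ ?_).comp hts)).post φ'.contDiff.contDiffAt
      · rw [hs1]
        exact mem_chartNear_source _
      · rw [ht1]
        exact mem_chartNear_source _
    exact h1.comp_plot_univ hσp rfl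
  refine ⟨fun w => Ψ'.symm (q w, (Ψ' g).2), ?_, ?_, ?_⟩
  · exact hΨ'.coord.plotAt_symm (hqs.contDiffWithinAt.prodMk contDiffWithinAt_const) (mem_univ _)
      (by rw [hq0]; exact Ψ'.map_source hgΨ')
  · simp only [hq0, Ψ'.left_inv hgΨ']
  · have h1 : ∀ᶠ w in 𝓝 (C (Γ.toComponent g)), C.symm w ∈ Γ.toComponent '' Ψ'.source :=
      (C.continuousAt_symm hCt).eventually (p := fun e => e ∈ Γ.toComponent '' Ψ'.source) (by
        rw [C.left_inv hg]
        exact (hΓ.isOpenMap_toComponent _ Ψ'.open_source).mem_nhds ⟨g, hgΨ', rfl⟩)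
    filter_upwards [h1] with w hw
    obtain ⟨h, hh, hhw⟩ := hw
    rw [← hhw]
    obtain ⟨h2, h3⟩ := s_t_of_mem_component (toComponent_eq_iff.1 (hhw.trans (hπσ w).symm))
    have h4 : q w = (Ψ' h).1 := by
      simp only [hq, h2, h3]
      exact (hΨ'.fst_eq h hh).symm
    have h5 : (q w, (Ψ' g).2) ∈ Ψ'.target := by
      rw [h4]
      exact hΨ'.mk_mem_target hh hgΨ'
    refine toComponent_eq_iff.2 (hΨ'.mem_component (Ψ'.map_target h5) hh ?_)
    rw [Ψ'.right_inv h5, h4]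

theorem IsRegular.exists_quotientCoord (hΓ : Γ.IsRegular) (e : Γ.ComponentSpace) :
    ∃ (n : ℕ) (C : OpenPartialHomeomorph Γ.ComponentSpace (Euc n)),
      IsQuotientCoord Γ.toComponent C ∧ e ∈ C.source := by
  obtain ⟨g, rfl⟩ := toComponent_surjective e
  obtain ⟨Z, _, _, _, φ, F, Ψ, b₀, z₀, r, hΨ, hgΨ⟩ := hΓ.exists_plaque_coord_chart g
  have L : Z ≃L[ℝ] Euc (Module.finrank ℝ Z) := ContinuousLinearEquiv.ofFinrankEq (by simp)
  exact ⟨_, _, (hΨ.isQuotientCoord hΓ).equiv L, hΨ.mem_quotientCoord_source hΓ hgΨ⟩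

/-- The smooth structure of the quotient groupoid. -/
@[reducible] def IsRegular.quotientManifold (hΓ : Γ.IsRegular) :
    SmoothManifold Γ.ComponentSpace :=
  LieGpd.quotientManifold Γ.toComponent toComponent_surjective hΓ.exists_quotientCoord

theorem IsRegular.isSubmersion_toComponent (hΓ : Γ.IsRegular) :
    letI := hΓ.quotientManifold
    IsSubmersion Γ.toComponent :=
  quotientManifold_isSubmersion toComponent_surjective continuous_toComponent
    hΓ.exists_quotientCoord

theorem IsRegular.isLie_quotient (hΓ : Γ.IsRegular) :
    letI := hΓ.quotientManifold
    (Γ.quotient hΓ.lie).IsLie := by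
  let := hΓ.quotientManifold
  have hπ : IsSubmersion Γ.toComponent := hΓ.isSubmersion_toComponent
  have hs := toComponent_surjective (Γ := Γ)
  have hhom := isHom_toComponent hΓ.lie
  refine ⟨hΓ.lie.hausdorff, hπ.of_comp_submersion hs hΓ.lie.s_submersion,
    hπ.of_comp_submersion hs hΓ.lie.t_submersion, ?_, ?_, ?_⟩
  · refine smoothMul_of_plots fun {V} _ _ a b S v ha hb hab => ?_
    obtain ⟨g, hg⟩ := hs (a v)
    obtain ⟨h, hh⟩ := hs (b v)
    obtain ⟨a', ha', -, hea⟩ := hπ.exists_lift ha hg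
    obtain ⟨b', hb', -, heb⟩ := hπ.exists_lift hb hh
    have hcomp : ∀ᶠ w in 𝓝[S] v, Γ.s (a' w) = Γ.t (b' w) := by
      filter_upwards [hea, heb, self_mem_nhdsWithin] with w h1 h2 hw
      rw [← hhom.s_map, ← hhom.t_map, h1, h2]
      exact hab w hw
    refine (hπ.1.plotAt (hΓ.lie.smooth_mul.plotAt ha' hb' hcomp)).congr ?_
    filter_upwards [hea, heb, hcomp] with w h1 h2 h3
    rw [hhom.map_mul _ _ h3, h1, h2]
  · refine Smooth.of_comp_submersion hπ hs (smooth_of_plots fun n p v hp => ?_)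
    simp only [← hhom.map_inv]
    exact hπ.1.plotAt (hΓ.lie.smooth_inv.plotAt hp)
  · exact smooth_of_plots fun n p v hp => hπ.1.plotAt (hΓ.lie.smooth_one.plotAt hp)

theorem IsRegular.isFoliation_quotient (hΓ : Γ.IsRegular) :
    letI := hΓ.quotientManifold
    (Γ.quotient hΓ.lie).IsFoliation := by
  let := hΓ.quotientManifold
  refine ⟨hΓ.isLie_quotient, fun x y => ?_⟩
  rw [discreteTopology_iff_isOpen_singleton]
  rintro ⟨e, he⟩
  obtain ⟨g, rfl⟩ := toComponent_surjective e
  obtain ⟨Z, _, _, _, φ, F, Ψ, b₀, z₀, r, hΨ, hgΨ⟩ := hΓ.exists_plaque_coord_chart g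
  set C := hΨ.quotientCoord hΓ
  have hgC := hΨ.mem_quotientCoord_source hΓ hgΨ
  convert C.open_source.preimage continuous_subtype_val using 1
  ext ⟨f, hf⟩
  rw [mem_singleton_iff, mem_preimage, Subtype.mk.injEq]
  constructor
  · rintro rfl
    exact hgC
  · intro hfC
    -- the coordinates of `f` are determined by its source and target
    refine C.injOn hfC hgC ?_
    change φ (_, _) = φ (_, _)
    rw [hf.1, hf.2, he.1, he.2]

end QuotientChart

end GroupoidStr

/-! ### Subgroupoids -/

theorem isConnected_of_image_val {X : Type*} [TopologicalSpace X] {P : Set X} {A : Set P}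
    (h : IsConnected (Subtype.val '' A)) : IsConnected A :=
  ⟨h.nonempty.of_image, IsInducing.subtypeVal.isPreconnected_image.1 h.isPreconnected⟩

namespace GroupoidStr

section Algebra

variable {M : Type u} {G : Type v} (Γ : GroupoidStr M G)

theorem inv_inv (g : G) : Γ.inv (Γ.inv g) = g := by
  have h1 := Γ.mul_assoc (g := Γ.inv (Γ.inv g)) (h := Γ.inv g) (k := g)
    (by rw [Γ.s_inv]) (Γ.s_inv g)
  rw [Γ.inv_mul, Γ.inv_mul, Γ.s_inv] at h1
  have h2 := Γ.mul_one (Γ.inv (Γ.inv g))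
  rw [Γ.s_inv, Γ.t_inv] at h2
  rw [← h2, ← h1, Γ.one_mul]

theorem inv_one (x : M) : Γ.inv (Γ.one x) = Γ.one x := by
  have h1 := Γ.mul_one (Γ.inv (Γ.one x))
  rw [Γ.s_inv, Γ.t_one] at h1
  rw [← h1, Γ.inv_mul, Γ.s_one]

/-- Sets of arrows that contain the units and are closed under products and inverses. -/
structure IsWide (N : Set G) : Prop where
  mul_mem : ∀ {g h}, g ∈ N → h ∈ N → Γ.s g = Γ.t h → Γ.mul g h ∈ N
  inv_mem : ∀ {g}, g ∈ N → Γ.inv g ∈ N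
  one_mem : ∀ x, Γ.one x ∈ N

variable {Γ}

open Classical in
/-- The groupoid with the same objects and with arrows in a wide set `N`. The product of
non-composable arrows has no meaning; it is set to the first factor. -/
noncomputable def IsWide.groupoid {N : Set G} (hN : Γ.IsWide N) : GroupoidStr M N where
  s g := Γ.s g
  t g := Γ.t g
  mul g h := if e : Γ.s g = Γ.t h then ⟨Γ.mul g h, hN.mul_mem g.2 h.2 e⟩ else g
  inv g := ⟨Γ.inv g, hN.inv_mem g.2⟩
  one x := ⟨Γ.one x, hN.one_mem x⟩
  s_mul e := by simp [e, Γ.s_mul e]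
  t_mul e := by simp [e, Γ.t_mul e]
  mul_assoc e f := by simp [e, f, Γ.s_mul e, Γ.t_mul f, Γ.mul_assoc e f]
  s_one := Γ.s_one
  t_one := Γ.t_one
  one_mul g := by simp [Γ.s_one, Γ.one_mul]
  mul_one g := by simp [Γ.t_one, Γ.mul_one]
  s_inv g := Γ.s_inv g
  t_inv g := Γ.t_inv g
  inv_mul g := by simp [Γ.s_inv, Γ.inv_mul]
  mul_inv g := by simp [Γ.t_inv, Γ.mul_inv]

theorem IsWide.isHom_val {N : Set G} (hN : Γ.IsWide N) :
    hN.groupoid.IsHom Γ (Subtype.val : N → G) where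
  s_map _ := rfl
  t_map _ := rfl
  map_mul g h e := by
    have e' : Γ.s g = Γ.t h := e
    simp [groupoid, e']
  map_inv _ := rfl
  map_one _ := rfl

theorem coe_restrict_mul {T : Set M} {g h : Γ.arrowsOver T}
    (e : (Γ.restrict T).s g = (Γ.restrict T).t h) :
    ((Γ.restrict T).mul g h : G) = Γ.mul g h := by
  have e' : Γ.s g = Γ.t h := congrArg Subtype.val e
  simp [restrict, e']

/-- The preimage of the units under a homomorphism. -/
theorem IsHom.isWide_ker {H : Type w} {Δ : GroupoidStr M H} {π : G → H} (hπ : Γ.IsHom Δ π) :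
    Γ.IsWide (π ⁻¹' range Δ.one) where
  mul_mem := by
    rintro g h ⟨x, hx⟩ ⟨y, hy⟩ e
    have h1 : x = y := by
      rw [← hπ.s_map, ← hπ.t_map, ← hx, ← hy, Δ.s_one, Δ.t_one] at e
      exact e
    refine ⟨x, ?_⟩
    have h2 := Δ.one_mul (Δ.one x)
    rw [Δ.t_one] at h2
    rw [hπ.map_mul g h e, ← hx, ← hy, ← h1, h2]
  inv_mem := by
    rintro g ⟨x, hx⟩
    exact ⟨x, by rw [hπ.map_inv, ← hx, Δ.inv_one]⟩
  one_mem x := ⟨x, (hπ.map_one x).symm⟩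

theorem IsHom.s_eq_t_of_mem_ker {H : Type w} {Δ : GroupoidStr M H} {π : G → H}
    (hπ : Γ.IsHom Δ π) {g : G} {x : M} (h : Δ.one x = π g) : Γ.s g = x ∧ Γ.t g = x := by
  rw [← hπ.s_map, ← hπ.t_map, ← h, Δ.s_one, Δ.t_one]
  exact ⟨rfl, rfl⟩

end Algebra

section Lie

variable {M : Type u} [TopologicalSpace M] [SmoothManifold M]
variable {G : Type v} [TopologicalSpace G] [SmoothManifold G] {Γ : GroupoidStr M G}

/-- As the inversion is a diffeomorphism, the source and target maps of a groupoid have the same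
properties. -/
theorem t_submersion_of_s (hs : IsSubmersion Γ.s) (hi : Smooth Γ.inv) : IsSubmersion Γ.t := by
  refine isSubmersion_of_lift (smooth_of_plots fun n p v hp => ?_) fun n p v g hp hg => ?_
  · have := hs.1.plotAt (hi.plotAt hp)
    simpa only [Γ.s_inv] using this
  · obtain ⟨q, hq, hqv, hev⟩ := hs.exists_lift hp (x₀ := Γ.inv g) (by rw [Γ.s_inv, hg])
    rw [nhdsWithin_univ] at hev
    refine ⟨fun w => Γ.inv (q w), hi.plotAt hq, by simp only [hqv, Γ.inv_inv], ?_⟩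
    filter_upwards [hev] with w hw
    rw [Γ.t_inv, hw]

theorem IsLie.of_isInduced_wide (hΓ : Γ.IsLie) {N : Set G} (hN : Γ.IsWide N) [SmoothManifold N]
    (hi : IsInduced N) (hs : IsSubmersion hN.groupoid.s) : hN.groupoid.IsLie := by
  have hinv : Smooth hN.groupoid.inv := smooth_of_plots fun n p v hp =>
    hi.plotAt (hΓ.smooth_inv.plotAt (hi.smooth_val.plotAt hp))
  refine ⟨hΓ.hausdorff, hs, t_submersion_of_s hs hinv, ?_, hinv, ?_⟩
  · refine smoothMul_of_plots fun {V} _ _ a b S v ha hb hab => hi.plotAt ?_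
    refine (hΓ.smooth_mul.plotAt (hi.smooth_val.plotAt ha) (hi.smooth_val.plotAt hb)
      (Filter.eventually_of_mem self_mem_nhdsWithin hab)).congr ?_
    filter_upwards [self_mem_nhdsWithin] with w hw
    exact hN.isHom_val.map_mul _ _ (hab w hw)
  · exact smooth_of_plots fun n p v hp => hi.plotAt (hΓ.smooth_one.plotAt hp)

theorem IsLie.restrict_of_isInduced (hΓ : Γ.IsLie) {T : Set M} [SmoothManifold T]
    (hT : IsInduced T) [SmoothManifold (Γ.arrowsOver T)] (hi : IsInduced (Γ.arrowsOver T))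
    (hs : IsSubmersion (Γ.restrict T).s) : (Γ.restrict T).IsLie := by
  have := hΓ.hausdorff
  have hinv : Smooth (Γ.restrict T).inv := smooth_of_plots fun n p v hp =>
    hi.plotAt (hΓ.smooth_inv.plotAt (hi.smooth_val.plotAt hp))
  refine ⟨inferInstance, hs, t_submersion_of_s hs hinv, ?_, hinv, ?_⟩
  · refine smoothMul_of_plots fun {V} _ _ a b S v ha hb hab => hi.plotAt ?_
    refine (hΓ.smooth_mul.plotAt (hi.smooth_val.plotAt ha) (hi.smooth_val.plotAt hb)
      (Filter.eventually_of_mem self_mem_nhdsWithin fun w hw =>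
        congrArg Subtype.val (hab w hw))).congr ?_
    filter_upwards [self_mem_nhdsWithin] with w hw
    exact coe_restrict_mul (hab w hw)
  · exact smooth_of_plots fun n p v hp => hi.plotAt (hΓ.smooth_one.plotAt (hT.smooth_val.plotAt hp))

/-! ### The bundle of identity components -/

/-- The units form a submanifold, as the image of a section of the source map. -/
theorem isSubmfd_preimage_units {H : Type w} [TopologicalSpace H] [SmoothManifold H]
    {Δ : GroupoidStr M H} {π : G → H} (hπs : IsSubmersion π) (hΔ : Δ.IsLie) :
    IsSubmfd (π ⁻¹' range Δ.one) :=
  (isSubmfd_range_section hΔ.smooth_one hΔ.s_submersion.1 Δ.s_one).preimage hπs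

theorem IsHom.isConnectedBundle_ker {H : Type w} [TopologicalSpace H] [SmoothManifold H]
    {Δ : GroupoidStr M H} {π : G → H} (hΓ : Γ.IsLie) (hΔ : Δ.IsLie) (hπ : Γ.IsHom Δ π)
    (hπs : IsSubmersion π) (hconn : ∀ x, IsConnected (π ⁻¹' {Δ.one x})) :
    letI := (isSubmfd_preimage_units hπs hΔ).smoothManifold
    hπ.isWide_ker.groupoid.IsConnectedBundle := by
  have hN := isSubmfd_preimage_units hπs hΔ
  let := hN.smoothManifold
  have hi : IsInduced (π ⁻¹' range Δ.one) := hN.isInduced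
  refine ⟨hΓ.of_isInduced_wide _ hi ?_, ?_, fun x => ?_⟩
  · refine isSubmersion_of_lift (smooth_of_plots fun n p v hp =>
      hΓ.s_submersion.1.plotAt (hi.smooth_val.plotAt hp)) fun n p v g hp hg => ?_
    -- lift the plot of units of the base along `π`
    obtain ⟨x, hx⟩ := g.2
    have h1 : π g = Δ.one (p v) := by
      rw [← hx, ← hg]
      exact congrArg _ (hπ.s_eq_t_of_mem_ker hx).1.symm
    obtain ⟨q, hq, hqv, hev⟩ := hπs.exists_lift (hΔ.smooth_one.plotAt hp) h1
    obtain ⟨r, hr, hrq⟩ := hi.exists_plot hq (hev.mono fun w hw => ⟨p w, hw.symm⟩)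
    rw [nhdsWithin_univ] at hev
    refine ⟨r, hr, ?_, ?_⟩
    · refine Subtype.ext ?_
      rw [hrq v (by rw [hqv]; exact g.2), hqv]
    · filter_upwards [hev] with w hw
      have h2 : (r w : G) = q w := hrq w ⟨p w, hw.symm⟩
      change Γ.s (r w) = p w
      rw [h2]
      exact (hπ.s_eq_t_of_mem_ker hw.symm).1
  · funext ⟨g, x, hx⟩
    obtain ⟨h1, h2⟩ := hπ.s_eq_t_of_mem_ker hx
    exact h1.trans h2.symm
  · refine isConnected_of_image_val ?_
    convert hconn x
    ext g
    constructor
    · rintro ⟨⟨g, y, hy⟩, hg, rfl⟩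
      have hg' : Γ.s g = x := hg
      rw [(hπ.s_eq_t_of_mem_ker hy).1] at hg'
      rw [mem_preimage, mem_singleton_iff, ← hy, hg']
    · intro hg
      exact ⟨⟨g, x, hg.symm⟩, (hπ.s_eq_t_of_mem_ker (Eq.symm hg)).1, rfl⟩

theorem preimage_range_quotient_one (hΓ : Γ.IsLie) :
    Γ.toComponent ⁻¹' range (Γ.quotient hΓ).one = Γ.isotropyIdentity := by
  ext g
  rw [mem_isotropyIdentity_iff]
  exact exists_congr fun x => eq_comm

theorem IsRegular.isExtension (hΓ : Γ.IsRegular) :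
    letI := hΓ.quotientManifold
    letI := (isSubmfd_preimage_units hΓ.isSubmersion_toComponent hΓ.isLie_quotient).smoothManifold
    GroupoidStr.IsExtension (isHom_toComponent hΓ.lie).isWide_ker.groupoid Γ
      (Γ.quotient hΓ.lie) Subtype.val Γ.toComponent := by
  let := hΓ.quotientManifold
  have hN := isSubmfd_preimage_units hΓ.isSubmersion_toComponent hΓ.isLie_quotient
  let := hN.smoothManifold
  refine ⟨(isHom_toComponent hΓ.lie).isWide_ker.isHom_val, hN.isSmoothEmbedding,
    isHom_toComponent hΓ.lie, hΓ.isSubmersion_toComponent, toComponent_surjective, fun g => ?_,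
    fun g h => ?_⟩
  · rw [Subtype.range_coe]
    rfl
  · rw [hΓ.lie.toComponent_eq_iff_exists_mul, ← preimage_range_quotient_one hΓ.lie]
    exact ⟨fun ⟨k, hk, h⟩ => ⟨⟨k, hk⟩, h⟩, fun ⟨k, h⟩ => ⟨k, k.2, h⟩⟩

/-! ### Restriction to a transversal -/

/-- Coordinates of the quotient in which the arrows over the transversal form a slice, on which
the source map is a coordinate projection. -/
theorem IsRegular.exists_transversal_chart (hΓ : Γ.IsRegular) {T : Set M} [SmoothManifold T]
    (hT : Γ.IsTransversal T) (e₀ : (Γ.quotient hΓ.lie).arrowsOver T) :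
    letI := hΓ.quotientManifold
    ∃ (U : Set Γ.ComponentSpace) (O : Set (Tan (((Γ.quotient hΓ.lie).restrict T).s e₀)))
      (a : Γ.ComponentSpace → Tan (((Γ.quotient hΓ.lie).restrict T).s e₀))
      (b : Tan (((Γ.quotient hΓ.lie).restrict T).s e₀) → Γ.ComponentSpace),
      IsSubChart ((Γ.quotient hΓ.lie).arrowsOver T) U O a b ∧ (e₀ : Γ.ComponentSpace) ∈ U ∧
      ∀ e : (Γ.quotient hΓ.lie).arrowsOver T, (e : Γ.ComponentSpace) ∈ U →
        ((Γ.quotient hΓ.lie).restrict T).s e ∈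
          (chartNear (((Γ.quotient hΓ.lie).restrict T).s e₀)).source ∧
        chartNear (((Γ.quotient hΓ.lie).restrict T).s e₀)
          (((Γ.quotient hΓ.lie).restrict T).s e) = a e := by
  let := hΓ.quotientManifold
  obtain ⟨e₀, he₀⟩ := e₀
  obtain ⟨g₀, rfl⟩ := toComponent_surjective e₀
  have hg₀ : Γ.s g₀ ∈ T ∧ Γ.t g₀ ∈ T := he₀
  set x₀ : T := ((Γ.quotient hΓ.lie).restrict T).s ⟨_, he₀⟩ with hx₀
  set y₀ : T := ⟨Γ.t g₀, hg₀.2⟩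
  let F₁ := Γ.anchorImage (x₀ : M)
  let F₂ := Γ.anchorImage (y₀ : M)
  obtain ⟨Φ₁, hΦ₁, hxΦ₁, hT₁, hs₁, -⟩ := hT.embedding.exists_slice x₀ (hT.isCompl x₀)
  obtain ⟨Φ₂, hΦ₂, hyΦ₂, hT₂, hs₂, hd₂⟩ := hT.embedding.exists_slice y₀ (hT.isCompl y₀)
  let φ : (Tan x₀ × F₁) × (Tan y₀ × F₂) →L[ℝ] (Tan x₀ × F₁) × F₂ :=
    (ContinuousLinearMap.id ℝ _).prodMap (ContinuousLinearMap.snd ℝ _ _)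
  have hmap := hΓ.lie.map_ker_eq_anchorImage g₀ (x := Γ.t g₀) rfl rfl
  obtain ⟨F, Ψ, b₀, z₀, r, hΨ, hgΨ⟩ := hΓ.exists_plaque_coord g₀ hΦ₁ hxΦ₁ hΦ₂ hyΦ₂ (φ := φ) (by
      rintro ⟨a, f⟩
      obtain ⟨a', ha'⟩ := hΦ₁.dAt_surjective hxΦ₁ a
      obtain ⟨u₁, hu₁⟩ := hΓ.lie.s_submersion.2 g₀ a'
      set f' : F₂ := f - (dAt Φ₂ (Γ.t g₀) (tanMap Γ.t g₀ rfl u₁)).2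
      have hf' : (f' : Tan (Γ.t g₀)) ∈ Γ.anchorImage (Γ.t g₀) := f'.2
      rw [← hmap] at hf'
      obtain ⟨u₂, hu₂, hu₂'⟩ := hf'
      have h1 : tanMap Γ.s g₀ rfl u₂ = 0 := hu₂
      have h2 : tanMap Γ.t g₀ rfl u₂ = f' := hu₂'
      refine ⟨u₁ + u₂, ?_⟩
      have h3 : dAt Φ₂ (Γ.t g₀) f' = (0, f') := hd₂ f'
      have h4 : tanMap Γ.s g₀ rfl (u₁ + u₂) = a' := by
        rw [map_add, h1, hu₁]
        exact add_zero a'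
      have h5 : dAt Φ₂ (Γ.t g₀) (tanMap Γ.t g₀ rfl (u₁ + u₂)) =
          dAt Φ₂ (Γ.t g₀) (tanMap Γ.t g₀ rfl u₁) + (0, f') := by
        rw [map_add, h2, map_add, h3]
      exact Prod.ext ((congrArg (dAt Φ₁ (Γ.s g₀)) h4).trans ha')
        ((congrArg Prod.snd h5).trans (add_sub_cancel _ _))) (by
      intro u hu
      have h1 := Prod.mk_eq_zero.1 hu
      have h2 : tanMap Γ.s g₀ rfl u = 0 := (map_eq_zero_iff _ (hΦ₁.dAt_injective hxΦ₁)).1 h1.1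
      have h3 : tanMap Γ.t g₀ rfl u ∈ Γ.anchorImage (Γ.t g₀) := by
        rw [← hmap]
        exact ⟨u, h2, rfl⟩
      have h4 := hd₂ ⟨_, h3⟩
      have h5 := congrArg Prod.snd h4
      have h6 : (⟨_, h3⟩ : Γ.anchorImage (Γ.t g₀)) = 0 := h5.symm.trans h1.2
      exact ⟨h2, congrArg Subtype.val h6⟩)
  set C := hΨ.quotientCoord hΓ
  have hC : IsCoord C := (hΨ.isQuotientCoord hΓ).isCoord hΓ.isSubmersion_toComponent
    toComponent_surjective
  have hCe : ∀ e, C e = (Φ₁ ((Γ.quotient hΓ.lie).s e), (Φ₂ ((Γ.quotient hΓ.lie).t e)).2) :=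
    fun e => rfl
  have hsrc : ∀ e ∈ C.source, (Γ.quotient hΓ.lie).s e ∈ Φ₁.source ∧
      (Γ.quotient hΓ.lie).t e ∈ Φ₂.source := by
    rintro _ ⟨g, hg, rfl⟩
    exact hΨ.source g hg
  have hval : ∀ e ∈ C.source, ∀ he : e ∈ (Γ.quotient hΓ.lie).arrowsOver T,
      ((Γ.quotient hΓ.lie).restrict T).s ⟨e, he⟩ ∈ (chartNear x₀).source ∧
      C e = ((chartNear x₀ (((Γ.quotient hΓ.lie).restrict T).s ⟨e, he⟩), 0), 0) := by
    intro e heC he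
    obtain ⟨h1, h2⟩ := hs₁ (((Γ.quotient hΓ.lie).restrict T).s ⟨e, he⟩) (hsrc e heC).1
    obtain ⟨-, h3⟩ := hs₂ (((Γ.quotient hΓ.lie).restrict T).t ⟨e, he⟩) (hsrc e heC).2
    refine ⟨h1, ?_⟩
    have h4 : (Φ₂ ((Γ.quotient hΓ.lie).t e)).2 = 0 := by
      have := congrArg Prod.snd h3
      exact this
    rw [hCe]
    exact Prod.ext h2 h4
  refine ⟨C.source, (fun w => ((w, 0), 0)) ⁻¹' C.target, fun e => (C e).1.1,
    fun w => C.symm ((w, 0), 0), ⟨C.open_source, ?_, ?_, ?_, ?_, ?_⟩,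
    hΨ.mem_quotientCoord_source hΓ hgΨ, ?_⟩
  · exact C.open_target.preimage (by fun_prop)
  · rintro e ⟨-, he⟩
    exact (hC.smAt e he).post (contDiffAt_fst.fst)
  · intro w hw
    exact hC.plotAt_symm
      ((contDiffWithinAt_id.prodMk contDiffWithinAt_const).prodMk contDiffWithinAt_const)
      (mem_univ _) hw
  · rintro e ⟨he, heC⟩
    have h1 := (hval e heC he).2
    have h2 : (((C e).1.1, 0), 0) = C e := by rw [h1]
    simp only [mem_preimage]
    rw [h2]
    exact ⟨C.map_source heC, C.left_inv heC⟩
  · intro w hw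
    have hwC := C.map_target hw
    have h1 := C.right_inv hw
    have h2 := hCe (C.symm ((w, 0), 0))
    rw [h1] at h2
    obtain ⟨x, hx⟩ := hT₁ _ (hsrc _ hwC).1 (congrArg (fun z => z.1.2) h2).symm
    obtain ⟨y, hy⟩ := hT₂ _ (hsrc _ hwC).2 (congrArg Prod.snd h2).symm
    exact ⟨⟨⟨hx ▸ x.2, hy ▸ y.2⟩, hwC⟩, congrArg (fun z => z.1.1) h1⟩
  · rintro ⟨e, he⟩ heC
    obtain ⟨h1, h2⟩ := hval e heC he
    exact ⟨h1, (congrArg (fun z => z.1.1) h2).symm⟩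

theorem IsRegular.isSubmfd_quotient_arrowsOver (hΓ : Γ.IsRegular) {T : Set M} [SmoothManifold T]
    (hT : Γ.IsTransversal T) :
    letI := hΓ.quotientManifold
    IsSubmfd ((Γ.quotient hΓ.lie).arrowsOver T) := by
  let := hΓ.quotientManifold
  intro e he
  obtain ⟨U, O, a, b, h, heU, -⟩ := hΓ.exists_transversal_chart hT ⟨e, he⟩
  exact ⟨_, U, O, a, b, h, heU⟩

/-- The restriction of the quotient groupoid to a transversal is étale. -/
theorem IsRegular.isEtale_quotient_restrict (hΓ : Γ.IsRegular) {T : Set M} [SmoothManifold T]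
    (hT : Γ.IsTransversal T) :
    letI := hΓ.quotientManifold
    letI := (hΓ.isSubmfd_quotient_arrowsOver hT).smoothManifold
    ((Γ.quotient hΓ.lie).restrict T).IsEtale := by
  let := hΓ.quotientManifold
  have hE := hΓ.isSubmfd_quotient_arrowsOver hT
  let := hE.smoothManifold
  have hi : IsInduced ((Γ.quotient hΓ.lie).arrowsOver T) := hE.isInduced
  have hs : IsLocalDiffeo ((Γ.quotient hΓ.lie).restrict T).s := by
    refine isLocalDiffeo_of_coord fun e₀ => ?_
    obtain ⟨U, O, a, b, h, heU, hs⟩ := hΓ.exists_transversal_chart hT e₀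
    refine ⟨_, h.toHomeo e₀, chartNear _, h.isCoord hE e₀, isCoord_chart (chartNear_mem _), heU, ?_⟩
    filter_upwards [(h.isOpen_source.preimage continuous_subtype_val).mem_nhds heU] with e he
    exact hs e he
  have hL := hΓ.isLie_quotient.restrict_of_isInduced hT.embedding.isInduced hi hs.isSubmersion
  refine ⟨hL, hs, ?_⟩
  have h1 := hs.comp_involution hL.smooth_inv (((Γ.quotient hΓ.lie).restrict T).inv_inv)
  simpa only [s_inv] using h1

theorem IsRegular.exists_restriction (hΓ : Γ.IsRegular) {T : Set M} [SmoothManifold T]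
    (hT : Γ.IsTransversal T) :
    letI := hΓ.quotientManifold
    ∃ (_ : SmoothManifold (Γ.arrowsOver T))
      (_ : SmoothManifold ((Γ.quotient hΓ.lie).arrowsOver T))
      (πT : Γ.arrowsOver T → (Γ.quotient hΓ.lie).arrowsOver T),
      IsSmoothEmbedding (Subtype.val : Γ.arrowsOver T → G) ∧
      IsSmoothEmbedding (Subtype.val : (Γ.quotient hΓ.lie).arrowsOver T → Γ.ComponentSpace) ∧
      (∀ g, (πT g : Γ.ComponentSpace) = Γ.toComponent g) ∧
      (Γ.restrict T).IsLie ∧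
      (Γ.restrict T).IsEtaleComponents ((Γ.quotient hΓ.lie).restrict T) πT := by
  let := hΓ.quotientManifold
  have hE := hΓ.isSubmfd_quotient_arrowsOver hT
  have hπ := hΓ.isSubmersion_toComponent
  have hhom := isHom_toComponent hΓ.lie
  have hG : IsSubmfd (Γ.arrowsOver T) := hE.preimage hπ
  let := hE.smoothManifold
  let := hG.smoothManifold
  have hiE : IsInduced ((Γ.quotient hΓ.lie).arrowsOver T) := hE.isInduced
  have hiG : IsInduced (Γ.arrowsOver T) := hG.isInduced
  have hetale := hΓ.isEtale_quotient_restrict hT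
  let πT : Γ.arrowsOver T → (Γ.quotient hΓ.lie).arrowsOver T := fun g => ⟨Γ.toComponent g, g.2⟩
  have hπT : IsSubmersion πT := by
    refine isSubmersion_of_lift (smooth_of_plots fun n p v hp =>
      hiE.plotAt (hπ.1.plotAt (hiG.smooth_val.plotAt hp))) fun n p v g hp hg => ?_
    obtain ⟨q, hq, hqv, hev⟩ := hπ.exists_lift (hiE.smooth_val.plotAt hp)
      (congrArg Subtype.val hg : Γ.toComponent g = p v)
    have hmem : ∀ w, Γ.toComponent (q w) = p w → q w ∈ Γ.arrowsOver T := by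
      intro w hw
      have h1 : Γ.toComponent (q w) ∈ (Γ.quotient hΓ.lie).arrowsOver T := by
        rw [hw]
        exact (p w).2
      exact h1
    obtain ⟨r, hr, hrq⟩ := hiG.exists_plot hq (hev.mono hmem)
    rw [nhdsWithin_univ] at hev
    refine ⟨r, hr, Subtype.ext ?_, ?_⟩
    · rw [hrq v (by rw [hqv]; exact g.2), hqv]
    · filter_upwards [hev] with w hw
      refine Subtype.ext ?_
      change Γ.toComponent (r w) = p w
      rw [hrq w (hmem w hw), hw]
  have hs : IsSubmersion (Γ.restrict T).s := hπT.comp hetale.s_etale.isSubmersion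
  refine ⟨hG.smoothManifold, hE.smoothManifold, πT, hG.isSmoothEmbedding, hE.isSmoothEmbedding,
    fun g => rfl, hΓ.lie.restrict_of_isInduced hT.embedding.isInduced hiG hs, hetale,
    ⟨fun g => rfl, fun g => rfl, fun g h e => ?_, fun g => ?_, fun x => ?_⟩,
    ⟨fun g => rfl, hπT, fun e => ?_, hetale.s_etale⟩⟩
  · refine Subtype.ext ?_
    rw [coe_restrict_mul (Γ := Γ.quotient hΓ.lie)
      (show ((Γ.quotient hΓ.lie).restrict T).s (πT g) =
        ((Γ.quotient hΓ.lie).restrict T).t (πT h) from e)]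
    change Γ.toComponent ((Γ.restrict T).mul g h) = _
    rw [coe_restrict_mul e]
    exact hhom.map_mul g h (congrArg Subtype.val e)
  · exact Subtype.ext (hhom.map_inv g)
  · exact Subtype.ext (hhom.map_one x)
  · refine isConnected_of_image_val ?_
    convert isConnected_fiber_toComponent (e : Γ.ComponentSpace) using 1
    ext g
    constructor
    · rintro ⟨g, hg, rfl⟩
      exact congrArg Subtype.val hg
    · intro hg
      have h1 : Γ.toComponent g ∈ (Γ.quotient hΓ.lie).arrowsOver T := by
        rw [show Γ.toComponent g = e from hg]
        exact e.2
      exact ⟨⟨g, h1⟩, Subtype.ext hg, rfl⟩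

end Lie

end GroupoidStr

end LieGpd

open LieGpd
theorem proposition2p5 {M : Type u} [TopologicalSpace M] [SmoothManifold M]
    {G : Type v} [TopologicalSpace G] [SmoothManifold G]
    (Γ : GroupoidStr M G) (hΓ : Γ.IsRegular) :
    ∃ (K : Type v) (_ : TopologicalSpace K) (_ : SmoothManifold K) (κ : GroupoidStr M K)
      (E : Type v) (_ : TopologicalSpace E) (_ : SmoothManifold E) (ε : GroupoidStr M E)
      (j : K → G) (π : G → E),
      range j = Γ.isotropyIdentity ∧
      κ.IsConnectedBundle ∧
      ε.IsFoliation ∧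
      GroupoidStr.IsExtension κ Γ ε j π ∧
      (∀ e, IsConnected (π ⁻¹' {e})) ∧
      ∀ (T : Set M) (_ : SmoothManifold T), Γ.IsTransversal T →
        ∃ (_ : SmoothManifold (Γ.arrowsOver T)) (_ : SmoothManifold (ε.arrowsOver T))
          (πT : Γ.arrowsOver T → ε.arrowsOver T),
          IsSmoothEmbedding (Subtype.val : Γ.arrowsOver T → G) ∧
          IsSmoothEmbedding (Subtype.val : ε.arrowsOver T → E) ∧
          (∀ g, (πT g : E) = π g) ∧
          (Γ.restrict T).IsLie ∧
          (Γ.restrict T).IsEtaleComponents (ε.restrict T) πT := by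
  let := hΓ.quotientManifold
  have hN := GroupoidStr.isSubmfd_preimage_units hΓ.isSubmersion_toComponent hΓ.isLie_quotient
  refine ⟨_, inferInstance, hN.smoothManifold,
    (GroupoidStr.isHom_toComponent hΓ.lie).isWide_ker.groupoid, Γ.ComponentSpace, inferInstance,
    hΓ.quotientManifold, Γ.quotient hΓ.lie, Subtype.val, Γ.toComponent, ?_, ?_,
    hΓ.isFoliation_quotient, hΓ.isExtension, GroupoidStr.isConnected_fiber_toComponent,
    fun T _ hT => hΓ.exists_restriction hT⟩
  · rw [Subtype.range_coe, GroupoidStr.preimage_range_quotient_one]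
  · exact GroupoidStr.IsHom.isConnectedBundle_ker hΓ.lie hΓ.isLie_quotient
      (GroupoidStr.isHom_toComponent hΓ.lie) hΓ.isSubmersion_toComponent
      fun x => GroupoidStr.isConnected_fiber_toComponent _
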